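/- Let $\Omega=\{(x,y)\in\mathbb{R}^2 : x^2+y^2>1,\ y>0\}$ and $\mathcal{E}=\{x\in\mathbb{R} : |x|>1\}$. Let $v\in W^{1,2}(\mathcal{E})$ be real-valued; then $v$ has a representative that is continuous on $\overline{\mathcal{E}}$, again denoted by $v$. Consider the mixed problem $$ \begin{cases} \dfrac{\partial^2\psi}{\partial x^2}(x,y)+\dfrac{\partial^2\psi}{\partial y^2}(x,y)=0 & (x^2+y^2>1,\ y>0),\\[2mm] \dfrac{\partial\psi}{\partial r}(x,y)=0 & (x^2+y^2=1,\ y>0),\\[2mm] \psi(x,0)=v(x) & (|x|>1), \end{cases} \qquad \frac{\partial\psi}{\partial r}=\frac{x}{\sqrt{x^2+y^2}}\frac{\partial\psi}{\partial x}+\frac{y}{\sqrt{x^2+y^2}}\frac{\partial\psi}{\partial y}. $$ This problem has a unique solution $\psi=D_\Omega v$ in the class of functions that are continuous and bounded on $\overline\Omega$, and $$ (D_\Omega v)(x,y)= \begin{cases} \dfrac1\pi\displaystyle\int_{\mathcal{E}}\left[\frac{y}{(x-\tilde x)^2+y^2}+\frac{y}{(x\tilde x-1)^2+y^2\tilde x^2}\right]v(\tilde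 x)\,d\tilde x & ((x,y)\in\overline\Omega,\ y>0),\\[2mm] v(x) & (x\in\overline{\mathcal{E}},\ y=0). \end{cases} $$ Here $D_\Omega v$ satisfies the condition $\partial\psi/\partial r=0$ both classically ($\psi$ is differentiable, relative to $\overline\Omega$, at every point of the open half-circle) and weakly, i.e. for every $\varphi\in C_c^\infty((0,\pi))$ the function $r\mapsto\int_0^\pi\psi(r\cos\theta,r\sin\theta)\varphi(\theta)\,d\theta$ on $[1,\infty)$ has derivative $0$ at $r=1$; uniqueness holds whichever of the two senses is used. Moreover, let $\eta(x)=v(x)$ for $|x|\ge1$, $\eta(x)=v(1/x)$ for $0<|x|<1$, $\eta(0)=0$, and let $\tilde\psi(x,y)=\frac1\pi\int_{\mathbb{R}}\frac{y}{(x-\tilde x)^2+y^2}\,\eta(\tilde x)\,d\tilde x$ for $y>0$, $\tilde\psi(x,0)=\eta(x)$. Then $D_\Omega v=\tilde\psi$ on $\overline\Omega$, and $\tilde\psi(x,y)=(D_\Omega v)\left(\frac{x}{x^2+y^2},\frac{y}{x^2+y^2}\right)$ whenever $y\ge0$ and $0<x^2+y^2<1$. -/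

import Mathlib

open MeasureTheory Set InnerProductSpace
open scoped ContDiff

noncomputable section

namespace FloatingBody

/-- The free surface `{x ∈ ℝ : |x| > 1}`. -/
def freeSurface : Set ℝ := {x | 1 < |x|}

/-- The fluid domain `{(x, y) : x² + y² > 1, y > 0}`; a point `(x, y)` is the complex number
`x + i y`. -/
def fluidDomain : Set ℂ := {z | 1 < z.re ^ 2 + z.im ^ 2 ∧ 0 < z.im}

/-- The open half-circle `{(x, y) : x² + y² = 1, y > 0}`. -/
def halfCircle : Set ℂ := {z | z.re ^ 2 + z.im ^ 2 = 1 ∧ 0 < z.im}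

/-- `v` represents an element of the Sobolev space `W^{1,2}(U)`, for `U ⊆ ℝ` open: `v` and its
weak derivative are square integrable on `U`. -/
def MemW12 (U : Set ℝ) (v : ℝ → ℝ) : Prop :=
  MemLp v 2 (volume.restrict U) ∧
    ∃ g : ℝ → ℝ, MemLp g 2 (volume.restrict U) ∧
      ∀ φ : ℝ → ℝ, ContDiff ℝ ∞ φ → HasCompactSupport φ → tsupport φ ⊆ U →
        ∫ x in U, v x * deriv φ x = -∫ x in U, g x * φ x

/-- The radial derivative `(x/r) ∂ψ/∂x + (y/r) ∂ψ/∂y`, `r = √(x² + y²)`, of a function on the closed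
fluid domain. -/
def radialDeriv (ψ : ℂ → ℝ) (z : ℂ) : ℝ :=
  z.re / √(z.re ^ 2 + z.im ^ 2) * fderivWithin ℝ ψ (closure fluidDomain) z 1 +
    z.im / √(z.re ^ 2 + z.im ^ 2) * fderivWithin ℝ ψ (closure fluidDomain) z Complex.I

/-- `ψ` is continuous and bounded on the closed fluid domain. -/
def ContinuousBounded (ψ : ℂ → ℝ) : Prop :=
  ContinuousOn ψ (closure fluidDomain) ∧ ∃ C : ℝ, ∀ z ∈ closure fluidDomain, |ψ z| ≤ C

/-- The homogeneous Neumann condition on the half-circle in the classical sense. -/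
def ClassicalNeumann (ψ : ℂ → ℝ) : Prop :=
  ∀ z ∈ halfCircle, DifferentiableWithinAt ℝ ψ (closure fluidDomain) z ∧ radialDeriv ψ z = 0

/-- The homogeneous Neumann condition on the half-circle in the weak sense: the radial derivative
at `r = 1` vanishes after integration against any test function of the angle `θ ∈ (0, π)`. -/
def WeakNeumann (ψ : ℂ → ℝ) : Prop :=
  ∀ φ : ℝ → ℝ, ContDiff ℝ ∞ φ → HasCompactSupport φ → tsupport φ ⊆ Ioo 0 Real.pi →
    HasDerivWithinAt
      (fun r : ℝ => ∫ θ in (0 : ℝ)..Real.pi,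
        ψ ⟨r * Real.cos θ, r * Real.sin θ⟩ * φ θ) 0 (Ici 1) 1

/-- Bounded continuous classical solutions of the mixed problem with trace `v`. -/
structure IsClassicalSolution (v : ℝ → ℝ) (ψ : ℂ → ℝ) : Prop where
  continuousBounded : ContinuousBounded ψ
  harmonic : HarmonicOnNhd ψ fluidDomain
  neumann : ClassicalNeumann ψ
  trace : ∀ x ∈ freeSurface, ψ (x : ℂ) = v x

/-- Bounded continuous solutions of the mixed problem with trace `v`, where the Neumann condition
is understood in the weak sense. -/
structure IsWeakSolution (v : ℝ → ℝ) (ψ : ℂ → ℝ) : Prop where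
  continuousBounded : ContinuousBounded ψ
  harmonic : HarmonicOnNhd ψ fluidDomain
  neumann : WeakNeumann ψ
  trace : ∀ x ∈ freeSurface, ψ (x : ℂ) = v x

/-- The explicit formula with the Poisson-type kernel; only its values on the closed fluid domain
are meaningful. -/
def dirichletOmega (v : ℝ → ℝ) (z : ℂ) : ℝ :=
  if 0 < z.im then
    (1 / Real.pi) * ∫ t in freeSurface,
      (z.im / ((z.re - t) ^ 2 + z.im ^ 2) +
        z.im / ((z.re * t - 1) ^ 2 + z.im ^ 2 * t ^ 2)) * v t
  else v z.re

/-- The symmetric extension of `v` from `|x| ≥ 1` to the real line through `x ↦ 1 / x`. -/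
def symmExtension (v : ℝ → ℝ) (x : ℝ) : ℝ :=
  if 1 ≤ |x| then v x else if x = 0 then 0 else v (1 / x)

/-- The Poisson extension of `η` to the closed upper half-plane. -/
def dirichletHalfPlane (η : ℝ → ℝ) (z : ℂ) : ℝ :=
  if 0 < z.im then
    ∫ t : ℝ, z.im / (Real.pi * ((z.re - t) ^ 2 + z.im ^ 2)) * η t
  else η z.re

end FloatingBody

end

/-!
The inversion `x ↦ 1 / x` folds the Poisson kernel of the half-plane onto the kernel of the explicit
formula, so that `dirichletOmega w` is the Poisson extension of data which are symmetric under the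
inversion. Hence it is invariant under reflection in the unit circle, and its radial derivative
vanishes there.

For uniqueness, `exp` maps the half-strip `0 ≤ s`, `0 ≤ θ ≤ π` onto the closed domain and turns the
half-circle into the edge `s = 0`. The maximum principle applies after adding a multiple of the
positive harmonic function `(e^(s/2) + 2 e^(-s/2)) cos ((θ - π/2) / 2)`, which decreases strictly
away from that edge and exceeds every bounded function at infinity. The weak Neumann condition
becomes the pointwise one after averaging in `θ`.

The trace of an element of `W^{1,2}` is continuous because subtracting a primitive of the weak
derivative leaves a locally constant function (du Bois-Reymond), and bounded because its oscillation
and its `L²` norm are bounded on intervals of unit length.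
-/

namespace FloatingBody

/-! ### Weak derivatives on the line -/

/-- `φ` is a test function on `U`, i.e. an element of `C_c^∞(U)`. -/
structure IsTestFunction (U : Set ℝ) (φ : ℝ → ℝ) : Prop where
  contDiff : ContDiff ℝ ∞ φ
  hasCompactSupport : HasCompactSupport φ
  tsupport_subset : tsupport φ ⊆ U

/-- `g` is the weak derivative of `v` on `U`. Local integrability of `v` and `g` is not part of the
definition: the lemmas assume it separately where they need it. -/
def HasWeakDerivOn (v g : ℝ → ℝ) (U : Set ℝ) : Prop :=
  ∀ φ, IsTestFunction U φ → ∫ x in U, v x * deriv φ x = -∫ x in U, g x * φ x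

namespace IsTestFunction

variable {U U' : Set ℝ} {φ χ f : ℝ → ℝ}

theorem mono (hφ : IsTestFunction U φ) (h : U ⊆ U') : IsTestFunction U' φ :=
  ⟨hφ.contDiff, hφ.hasCompactSupport, hφ.tsupport_subset.trans h⟩

theorem sub (hφ : IsTestFunction U φ) (hχ : IsTestFunction U χ) :
    IsTestFunction U fun x => φ x - χ x :=
  ⟨hφ.contDiff.sub hχ.contDiff, hφ.hasCompactSupport.sub hχ.hasCompactSupport,
    (tsupport_sub φ χ).trans (union_subset hφ.tsupport_subset hχ.tsupport_subset)⟩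

theorem const_mul (c : ℝ) (hφ : IsTestFunction U φ) : IsTestFunction U fun x => c * φ x :=
  ⟨contDiff_const.mul hφ.contDiff, hφ.hasCompactSupport.mul_left,
    (tsupport_mul_subset_right (f := fun _ => c)).trans hφ.tsupport_subset⟩

theorem deriv (hφ : IsTestFunction U φ) : IsTestFunction U (deriv φ) :=
  ⟨hφ.contDiff.deriv', hφ.hasCompactSupport.deriv,
    tsupport_deriv_subset.trans hφ.tsupport_subset⟩

theorem comp_neg (hφ : IsTestFunction (Neg.neg ⁻¹' U) φ) : IsTestFunction U fun x => φ (-x) := by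
  refine ⟨hφ.contDiff.comp contDiff_neg, hφ.hasCompactSupport.comp_homeomorph (Homeomorph.neg ℝ),
    fun x hx => ?_⟩
  have hx' : x ∈ Homeomorph.neg ℝ ⁻¹' tsupport φ :=
    tsupport_comp_eq_preimage φ (Homeomorph.neg ℝ) ▸ hx
  simpa using hφ.tsupport_subset hx'

theorem eq_zero_of_notMem (hφ : IsTestFunction U φ) {x : ℝ} (hx : x ∉ U) : φ x = 0 :=
  image_eq_zero_of_notMem_tsupport fun h => hx (hφ.tsupport_subset h)

theorem setIntegral_mul (hφ : IsTestFunction U φ) (f : ℝ → ℝ) :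
    ∫ x in U, f x * φ x = ∫ x, f x * φ x :=
  setIntegral_eq_integral_of_forall_compl_eq_zero fun x hx => by
    rw [hφ.eq_zero_of_notMem hx, mul_zero]

theorem integrable_mul (hφ : IsTestFunction U φ) (hf : LocallyIntegrableOn f U) :
    Integrable fun x => f x * φ x := by
  have hf' : IntegrableOn f (tsupport φ) :=
    hf.integrableOn_compact_subset hφ.tsupport_subset hφ.hasCompactSupport
  refine (integrableOn_iff_integrable_of_support_subset fun x hx => ?_).1
    (hf'.mul_continuousOn hφ.contDiff.continuous.continuousOn hφ.hasCompactSupport)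
  exact subset_tsupport φ (right_ne_zero_of_mul hx)

theorem integrable (hφ : IsTestFunction U φ) : Integrable φ :=
  hφ.contDiff.continuous.integrable_of_hasCompactSupport hφ.hasCompactSupport

theorem exists_tsupport_subset_Icc (hU : U.OrdConnected) (hφ : IsTestFunction U φ) :
    ∃ α β, tsupport φ ⊆ Icc α β ∧ Icc α β ⊆ U := by
  rcases (tsupport φ).eq_empty_or_nonempty with hempty | hne
  · exact ⟨1, 0, by simp [hempty], by simp⟩
  · obtain ⟨α, hα, hα'⟩ := hφ.hasCompactSupport.isCompact.exists_isLeast hne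
    obtain ⟨β, hβ, hβ'⟩ := hφ.hasCompactSupport.isCompact.exists_isGreatest hne
    exact ⟨α, β, fun x hx => ⟨hα' hx, hβ' hx⟩,
      hU.out (hφ.tsupport_subset hα) (hφ.tsupport_subset hβ)⟩

theorem exists_deriv_eq_of_integral_eq_zero (hU : U.OrdConnected) (hφ : IsTestFunction U φ)
    (h0 : ∫ x, φ x = 0) : ∃ Ψ, IsTestFunction U Ψ ∧ _root_.deriv Ψ = φ := by
  obtain ⟨α, β, hαβ, hsub⟩ := hφ.exists_tsupport_subset_Icc hU
  have hc : Continuous φ := hφ.contDiff.continuous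
  have hsupp : Function.support φ ⊆ Ioo α β :=
    interior_Icc (a := α) (b := β) ▸
      interior_maximal ((subset_tsupport φ).trans hαβ) hc.isOpen_support
  have hderiv : ∀ x, HasDerivAt (fun x => ∫ t in α..x, φ t) (φ x) x := fun x =>
    hc.integral_hasStrictDerivAt α x |>.hasDerivAt
  have hderiv_eq : _root_.deriv (fun x => ∫ t in α..x, φ t) = φ := funext fun x => (hderiv x).deriv
  have hzero : ∀ x, x ∉ Icc α β → ∫ t in α..x, φ t = 0 := by
    intro x hx
    rcases lt_or_ge x α with hxα | hxα
    · refine intervalIntegral.integral_zero_ae (Filter.Eventually.of_forall fun t ht => ?_)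
      rw [uIoc_of_ge hxα.le] at ht
      exact Function.notMem_support.1 fun h => (hsupp h).1.not_ge ht.2
    · have hβx : β < x := lt_of_not_ge fun h => hx ⟨hxα, h⟩
      rw [intervalIntegral.integral_eq_integral_of_support_subset, h0]
      exact hsupp.trans fun t ht => ⟨ht.1, (ht.2.trans hβx).le⟩
  have htsupp : tsupport (fun x => ∫ t in α..x, φ t) ⊆ Icc α β :=
    closure_minimal (fun t ht => not_not.1 fun h => ht (hzero t h)) isClosed_Icc
  refine ⟨fun x => ∫ t in α..x, φ t, ⟨?_, ?_, htsupp.trans hsub⟩, hderiv_eq⟩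
  · exact contDiff_infty_iff_deriv.2
      ⟨fun x => (hderiv x).differentiableAt, hderiv_eq.symm ▸ hφ.contDiff⟩
  · exact HasCompactSupport.intro isCompact_Icc hzero

end IsTestFunction

theorem exists_isTestFunction_integral_eq_one {U : Set ℝ} (hU : IsOpen U) (hne : U.Nonempty) :
    ∃ χ, IsTestFunction U χ ∧ ∫ x, χ x = 1 := by
  obtain ⟨a, ha⟩ := hne
  obtain ⟨ε, hε, hεU⟩ := Metric.nhds_basis_closedBall.mem_iff.1 (hU.mem_nhds ha)
  let B : ContDiffBump a := ⟨ε / 2, ε, half_pos hε, half_lt_self hε⟩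
  exact ⟨B.normed volume, ⟨B.contDiff_normed, B.hasCompactSupport_normed,
    (B.tsupport_normed_eq (μ := volume)).symm ▸ hεU⟩, B.integral_normed⟩

namespace HasWeakDerivOn

variable {U U' : Set ℝ} {v g v₁ g₁ v₂ g₂ : ℝ → ℝ}

theorem mono (h : HasWeakDerivOn v g U) (hU : U' ⊆ U) : HasWeakDerivOn v g U' := fun φ hφ => by
  rw [hφ.deriv.setIntegral_mul, hφ.setIntegral_mul, ← (hφ.mono hU).deriv.setIntegral_mul,
    ← (hφ.mono hU).setIntegral_mul, h φ (hφ.mono hU)]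

theorem congr (h : HasWeakDerivOn v₁ g₁ U) (hv : v₁ =ᵐ[volume.restrict U] v₂)
    (hg : g₁ =ᵐ[volume.restrict U] g₂) : HasWeakDerivOn v₂ g₂ U := fun φ hφ => by
  have hvφ : ∫ x in U, v₁ x * deriv φ x = ∫ x in U, v₂ x * deriv φ x :=
    integral_congr_ae (hv.mul (ae_eq_refl (deriv φ)))
  have hgφ : ∫ x in U, g₁ x * φ x = ∫ x in U, g₂ x * φ x :=
    integral_congr_ae (hg.mul (ae_eq_refl φ))
  rw [← hvφ, ← hgφ, h φ hφ]

theorem comp_neg (h : HasWeakDerivOn v g U) :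
    HasWeakDerivOn (fun x => v (-x)) (fun x => -g (-x)) (Neg.neg ⁻¹' U) := fun φ hφ => by
  have hderiv : ∀ x, deriv (fun y => φ (-y)) x = -deriv φ (-x) := deriv_comp_neg φ
  have key := h _ hφ.comp_neg
  rw [hφ.comp_neg.deriv.setIntegral_mul, hφ.comp_neg.setIntegral_mul] at key
  rw [hφ.deriv.setIntegral_mul, hφ.setIntegral_mul,
    ← integral_neg_eq_self (fun x => v (-x) * deriv φ x),
    ← integral_neg_eq_self (fun x => -g (-x) * φ x)]
  simp only [hderiv, mul_neg, integral_neg, neg_neg, neg_mul] at key ⊢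
  linarith

theorem sub (h₁ : HasWeakDerivOn v₁ g₁ U) (h₂ : HasWeakDerivOn v₂ g₂ U)
    (hv₁ : LocallyIntegrableOn v₁ U) (hg₁ : LocallyIntegrableOn g₁ U)
    (hv₂ : LocallyIntegrableOn v₂ U) (hg₂ : LocallyIntegrableOn g₂ U) :
    HasWeakDerivOn (fun x => v₁ x - v₂ x) (fun x => g₁ x - g₂ x) U := fun φ hφ => by
  simp only [sub_mul]
  rw [integral_sub (hφ.deriv.integrable_mul hv₁).integrableOn
      (hφ.deriv.integrable_mul hv₂).integrableOn,
    integral_sub (hφ.integrable_mul hg₁).integrableOn (hφ.integrable_mul hg₂).integrableOn,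
    h₁ φ hφ, h₂ φ hφ]
  ring

/-- The lemma of du Bois-Reymond. -/
theorem exists_ae_eq_const (hU : IsOpen U) (hUc : U.OrdConnected) (hv : LocallyIntegrableOn v U)
    (h : HasWeakDerivOn v (fun _ => 0) U) : ∃ c, ∀ᵐ x, x ∈ U → v x = c := by
  rcases U.eq_empty_or_nonempty with rfl | hne
  · exact ⟨0, by simp⟩
  obtain ⟨χ, hχ, hχ1⟩ := exists_isTestFunction_integral_eq_one hU hne
  refine ⟨∫ x, v x * χ x, ?_⟩
  have key : ∀ φ, IsTestFunction U φ → ∫ x, v x * φ x = (∫ x, φ x) * ∫ x, v x * χ x := by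
    intro φ hφ
    have h0 : ∫ x, (φ x - (∫ x, φ x) * χ x) = 0 := by
      rw [integral_sub hφ.integrable (hχ.integrable.const_mul _), integral_const_mul, hχ1]; ring
    obtain ⟨Ψ, hΨ, hΨ'⟩ :=
      (hφ.sub (hχ.const_mul (∫ x, φ x))).exists_deriv_eq_of_integral_eq_zero hUc h0
    have hortho : ∫ x, v x * (φ x - (∫ x, φ x) * χ x) = 0 := by
      have := h Ψ hΨ
      rw [hΨ.deriv.setIntegral_mul, hΨ'] at this
      simpa using this
    simp only [mul_sub, mul_left_comm (v _)] at hortho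
    rw [integral_sub (hφ.integrable_mul hv) ((hχ.integrable_mul hv).const_mul _),
      integral_const_mul] at hortho
    linarith
  have hzero := hU.ae_eq_zero_of_integral_contDiff_smul_eq_zero (μ := volume)
    (f := fun x => v x - ∫ x, v x * χ x)
    (hv.sub ((locallyIntegrable_const _).locallyIntegrableOn U))
    fun φ hφ hφc hφU => by
      have hφ' : IsTestFunction U φ := ⟨hφ, hφc, hφU⟩
      simp only [smul_eq_mul, mul_sub, mul_comm (φ _) (v _)]
      rw [integral_sub (hφ'.integrable_mul hv) (hφ'.integrable.mul_const _), key φ hφ',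
        integral_mul_const, sub_self]
  filter_upwards [hzero] with x hx hxU
  exact sub_eq_zero.1 (hx hxU)

end HasWeakDerivOn

theorem hasWeakDerivOn_univ_primitive {g : ℝ → ℝ} (hg : LocallyIntegrable g) (a : ℝ) :
    HasWeakDerivOn (fun x => ∫ t in a..x, g t) g univ := by
  intro φ hφ
  obtain ⟨R, hR0, hR⟩ := hφ.hasCompactSupport.isCompact.isBounded.subset_ball_lt 0 a
  rw [Real.ball_eq_Ioo] at hR
  have hφR : IsTestFunction (Ioo (a - R) (a + R)) φ :=
    ⟨hφ.contDiff, hφ.hasCompactSupport, hR⟩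
  have hi : IntervalIntegrable g volume (a - R) (a + R) :=
    (hg.integrableOn_isCompact isCompact_uIcc).intervalIntegrable
  have ha : a ∈ uIcc (a - R) (a + R) :=
    Icc_subset_uIcc ⟨by linarith, by linarith⟩
  have hφac : AbsolutelyContinuousOnInterval φ (a - R) (a + R) :=
    (hφ.contDiff.of_le (by simp) : ContDiff ℝ 1 φ).contDiffOn.absolutelyContinuousOnInterval
  have ibp :=
    (hi.absolutelyContinuousOnInterval_intervalIntegral ha).integral_mul_deriv_eq_deriv_mul hφac
  have hderiv : ∫ x in (a - R)..(a + R), deriv (fun x => ∫ t in a..x, g t) x * φ x =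
      ∫ x in (a - R)..(a + R), g x * φ x := by
    refine intervalIntegral.integral_congr_ae ?_
    filter_upwards [hi.ae_hasDerivAt_integral] with x hx hx'
    rw [(hx (uIoc_subset_uIcc hx') a ha).deriv]
  rw [hderiv, hφR.eq_zero_of_notMem (by simp), hφR.eq_zero_of_notMem (by simp), mul_zero, mul_zero,
    sub_zero, zero_sub] at ibp
  have hintegral : ∀ f ψ : ℝ → ℝ, IsTestFunction (Ioo (a - R) (a + R)) ψ →
      ∫ x in (a - R)..(a + R), f x * ψ x = ∫ x, f x * ψ x := fun f ψ hψ =>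
    intervalIntegral.integral_eq_integral_of_support_subset fun x hx =>
      Ioo_subset_Ioc_self (hψ.tsupport_subset (subset_tsupport ψ (right_ne_zero_of_mul hx)))
  rwa [hintegral _ _ hφR.deriv, hintegral _ _ hφR, ← hφ.deriv.setIntegral_mul,
    ← hφ.setIntegral_mul] at ibp

theorem HasWeakDerivOn.exists_ae_eq_primitive_add_const {U : Set ℝ} {v g : ℝ → ℝ} (hU : IsOpen U)
    (hUc : U.OrdConnected) (h : HasWeakDerivOn v g U) (hv : LocallyIntegrableOn v U)
    (hg : LocallyIntegrable g) (a : ℝ) :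
    ∃ c, ∀ᵐ x, x ∈ U → v x = (∫ t in a..x, g t) + c := by
  have hprim : Continuous fun x => ∫ t in a..x, g t :=
    intervalIntegral.continuous_primitive
      (fun _ _ => (hg.integrableOn_isCompact isCompact_uIcc).intervalIntegrable) a
  have hgU : LocallyIntegrableOn g U := hg.locallyIntegrableOn U
  have hsub := h.sub ((hasWeakDerivOn_univ_primitive hg a).mono (subset_univ U)) hv hgU
    (hprim.locallyIntegrable.locallyIntegrableOn U) hgU
  simp only [sub_self] at hsub
  obtain ⟨c, hc⟩ := hsub.exists_ae_eq_const hU hUc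
    (hv.sub (hprim.locallyIntegrable.locallyIntegrableOn U))
  refine ⟨c, ?_⟩
  filter_upwards [hc] with x hx hxU
  exact sub_eq_iff_eq_add'.1 (hx hxU)

theorem intervalIntegral_abs_le_toReal_eLpNorm {f : ℝ → ℝ} {p : ENNReal} (hp : 1 ≤ p)
    (hf : MemLp f p) (x : ℝ) : ∫ t in x..x + 1, |f t| ≤ (eLpNorm f p volume).toReal := by
  have : IsProbabilityMeasure (volume.restrict (Ioc x (x + 1))) := ⟨by simp⟩
  have hf' : AEStronglyMeasurable f (volume.restrict (Ioc x (x + 1))) :=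
    hf.aestronglyMeasurable.restrict
  calc ∫ t in x..x + 1, |f t| = ∫ t in Ioc x (x + 1), ‖f t‖ :=
        intervalIntegral.integral_of_le (by linarith)
    _ = (eLpNorm f 1 (volume.restrict (Ioc x (x + 1)))).toReal := by
        rw [eLpNorm_one_eq_lintegral_enorm, integral_norm_eq_lintegral_enorm hf']
    _ ≤ (eLpNorm f p volume).toReal :=
        ENNReal.toReal_mono hf.eLpNorm_ne_top <|
          (eLpNorm_le_eLpNorm_of_exponent_le hp hf').trans
            (eLpNorm_mono_measure f Measure.restrict_le_self)

/-- Average `|w x| ≤ |w y| + |∫ t in x..y, g t|` over `y ∈ [x, x + 1]`. -/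
theorem abs_le_integral_abs_add_integral_abs {w g : ℝ → ℝ} (hw : Continuous w)
    (hg : LocallyIntegrable g) (h : ∀ x y, w y - w x = ∫ t in x..y, g t) (x : ℝ) :
    |w x| ≤ (∫ t in x..x + 1, |w t|) + ∫ t in x..x + 1, |g t| := by
  have hgi : ∀ a b, IntervalIntegrable g volume a b := fun _ _ =>
    (hg.integrableOn_isCompact isCompact_uIcc).intervalIntegrable
  have hpt : ∀ y ∈ Icc x (x + 1), |w x| ≤ |w y| + ∫ t in x..x + 1, |g t| := by
    intro y hy
    calc |w x| = |w y - ∫ t in x..y, g t| := by rw [← h x y, sub_sub_cancel]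
      _ ≤ |w y| + |∫ t in x..y, g t| := abs_sub _ _
      _ ≤ |w y| + ∫ t in x..y, |g t| := by
          gcongr; exact intervalIntegral.abs_integral_le_integral_abs hy.1
      _ ≤ |w y| + ∫ t in x..x + 1, |g t| := by
          gcongr
          exact intervalIntegral.integral_mono_interval le_rfl hy.1 hy.2
            (Filter.Eventually.of_forall fun t => abs_nonneg _) (hgi _ _).abs
  have havg := intervalIntegral.integral_mono_on (μ := volume) (f := fun _ => |w x|)
    (le_add_of_nonneg_right zero_le_one) intervalIntegrable_const
    (g := fun y => |w y| + ∫ t in x..x + 1, |g t|)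
    ((hw.abs.add continuous_const).intervalIntegrable _ _) hpt
  rw [intervalIntegral.integral_add (hw.abs.intervalIntegrable _ _)
    intervalIntegrable_const] at havg
  simpa using havg

theorem HasWeakDerivOn.exists_bounded_continuous_ae_eq {v g : ℝ → ℝ} {a : ℝ} {p : ENNReal}
    (h : HasWeakDerivOn v g (Ioi a)) (hp : 1 ≤ p) (hv : MemLp v p (volume.restrict (Ioi a)))
    (hg : MemLp g p (volume.restrict (Ioi a))) :
    ∃ w : ℝ → ℝ, Continuous w ∧ (∀ᵐ x, x ∈ Ioi a → v x = w x) ∧ ∃ C, ∀ x ∈ Ici a, |w x| ≤ C := by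
  have hv₀ : MemLp ((Ioi a).indicator v) p := (memLp_indicator_iff_restrict measurableSet_Ioi).2 hv
  have hg₀ : MemLp ((Ioi a).indicator g) p := (memLp_indicator_iff_restrict measurableSet_Ioi).2 hg
  have hgl : LocallyIntegrable ((Ioi a).indicator g) := hg₀.locallyIntegrable hp
  have hgi : ∀ x y, IntervalIntegrable ((Ioi a).indicator g) volume x y := fun _ _ =>
    (hgl.integrableOn_isCompact isCompact_uIcc).intervalIntegrable
  have h₀ : HasWeakDerivOn ((Ioi a).indicator v) ((Ioi a).indicator g) (Ioi a) :=
    h.congr (indicator_ae_eq_restrict measurableSet_Ioi).symm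
      (indicator_ae_eq_restrict measurableSet_Ioi).symm
  obtain ⟨c, hc⟩ := h₀.exists_ae_eq_primitive_add_const isOpen_Ioi ordConnected_Ioi
    ((hv₀.locallyIntegrable hp).locallyIntegrableOn _) hgl a
  have hw : Continuous fun x => (∫ t in a..x, (Ioi a).indicator g t) + c :=
    (intervalIntegral.continuous_primitive hgi a).add continuous_const
  refine ⟨_, hw, ?_, (eLpNorm ((Ioi a).indicator v) p volume).toReal +
    (eLpNorm ((Ioi a).indicator g) p volume).toReal, fun x hx => ?_⟩
  · filter_upwards [hc] with x hx hxa
    rw [← hx hxa, indicator_of_mem hxa]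
  refine (abs_le_integral_abs_add_integral_abs hw hgl (fun x y => ?_) x).trans
    (add_le_add ?_ (intervalIntegral_abs_le_toReal_eLpNorm hp hg₀ x))
  · rw [add_sub_add_right_eq_sub, intervalIntegral.integral_interval_sub_left (hgi _ _) (hgi _ _)]
  · refine (intervalIntegral.integral_congr_ae ?_).trans_le
      (intervalIntegral_abs_le_toReal_eLpNorm hp hv₀ x)
    filter_upwards [hc] with y hy hy'
    rw [uIoc_of_le (by linarith)] at hy'
    rw [hy (lt_of_le_of_lt hx hy'.1)]

/-! ### The free surface -/

theorem isOpen_freeSurface : IsOpen freeSurface := isOpen_lt continuous_const continuous_abs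

theorem freeSurface_eq_union : freeSurface = Iio (-1) ∪ Ioi 1 := by
  ext x
  simp only [freeSurface, mem_ofPred_eq, mem_union, mem_Iio, mem_Ioi, lt_abs, lt_neg, or_comm]

theorem closure_freeSurface : closure freeSurface = {x | 1 ≤ |x|} := by
  ext x
  simp only [freeSurface_eq_union, closure_union, closure_Iio, closure_Ioi, mem_union, mem_Iic,
    mem_Ici, mem_ofPred_eq, le_abs, le_neg, or_comm]

theorem neg_preimage_freeSurface : Neg.neg ⁻¹' freeSurface = freeSurface := by
  ext x; simp [freeSurface]

theorem Ioi_one_subset_freeSurface : Ioi 1 ⊆ freeSurface :=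
  freeSurface_eq_union ▸ subset_union_right

theorem MemW12.comp_neg {v : ℝ → ℝ} (hv : MemW12 freeSurface v) :
    MemW12 freeSurface fun x => v (-x) := by
  have hneg : MeasurePreserving (fun x : ℝ => -x) (volume.restrict freeSurface)
      (volume.restrict freeSurface) := by
    simpa only [neg_preimage_freeSurface] using
      (Measure.measurePreserving_neg (volume : Measure ℝ)).restrict_preimage
        isOpen_freeSurface.measurableSet
  obtain ⟨hv2, g, hg, h⟩ := hv
  have hweak : HasWeakDerivOn v g freeSurface := fun φ hφ => h φ hφ.1 hφ.2 hφ.3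
  exact ⟨hv2.comp_measurePreserving hneg, fun x => -g (-x),
    (hg.comp_measurePreserving hneg).neg, fun φ hφ hφc hφt =>
      (neg_preimage_freeSurface ▸ hweak.comp_neg) φ ⟨hφ, hφc, hφt⟩⟩

theorem MemW12.exists_bounded_continuous_ae_eq_Ioi {v : ℝ → ℝ} (hv : MemW12 freeSurface v) :
    ∃ w : ℝ → ℝ, Continuous w ∧ (∀ᵐ x, x ∈ Ioi 1 → v x = w x) ∧ ∃ C, ∀ x ∈ Ici 1, |w x| ≤ C := by
  obtain ⟨hv2, g, hg, h⟩ := hv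
  have hweak : HasWeakDerivOn v g freeSurface := fun φ hφ => h φ hφ.1 hφ.2 hφ.3
  have hμ := Measure.restrict_mono_set (volume : Measure ℝ) Ioi_one_subset_freeSurface
  exact (hweak.mono Ioi_one_subset_freeSurface).exists_bounded_continuous_ae_eq one_le_two
    (hv2.mono_measure hμ) (hg.mono_measure hμ)

theorem MemW12.exists_bounded_continuousOn_ae_eq {v : ℝ → ℝ} (hv : MemW12 freeSurface v) :
    ∃ w : ℝ → ℝ, ContinuousOn w (closure freeSurface) ∧
      v =ᵐ[volume.restrict freeSurface] w ∧ ∃ C, ∀ x, 1 ≤ |x| → |w x| ≤ C := by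
  obtain ⟨w₁, hw₁, hvw₁, C₁, hC₁⟩ := hv.exists_bounded_continuous_ae_eq_Ioi
  obtain ⟨w₂, hw₂, hvw₂, C₂, hC₂⟩ := hv.comp_neg.exists_bounded_continuous_ae_eq_Ioi
  have hpos : EqOn (fun x => if 0 < x then w₁ x else w₂ (-x)) w₁ (Ioi 0) := fun x hx => if_pos hx
  have hneg : EqOn (fun x => if 0 < x then w₁ x else w₂ (-x)) (fun x => w₂ (-x)) (Iio 0) :=
    fun x hx => if_neg (lt_asymm hx)
  refine ⟨fun x => if 0 < x then w₁ x else w₂ (-x), ?_, ?_, max C₁ C₂, fun x hx => ?_⟩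
  · have hsub : closure freeSurface ⊆ Iio 0 ∪ Ioi 0 := by
      rw [closure_freeSurface, Iio_union_Ioi]
      rintro x hx rfl
      norm_num at hx
    exact (((hw₂.comp continuous_neg).continuousOn.congr hneg).union_of_isOpen
      (hw₁.continuousOn.congr hpos) isOpen_Iio isOpen_Ioi).mono hsub
  · rw [Filter.EventuallyEq, ae_restrict_iff' isOpen_freeSurface.measurableSet]
    have hvw₂' :=
      (Measure.measurePreserving_neg (volume : Measure ℝ)).quasiMeasurePreserving.ae hvw₂
    filter_upwards [hvw₁, hvw₂'] with x hx₁ hx₂ hx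
    rcases lt_abs.1 (show 1 < |x| from hx) with h | h
    · exact (hx₁ h).trans (hpos (zero_lt_one.trans h)).symm
    · exact (neg_neg x ▸ hx₂ h).trans (hneg (neg_pos.1 (zero_lt_one.trans h))).symm
  · rcases le_abs.1 hx with h | h
    · exact (congrArg abs (hpos (zero_lt_one.trans_le h))).trans_le
        ((hC₁ x h).trans (le_max_left ..))
    · exact (congrArg abs (hneg (neg_pos.1 (zero_lt_one.trans_le h)))).trans_le
        ((hC₂ (-x) h).trans (le_max_right ..))

/-! ### The Poisson extension to the half-plane -/

section HalfPlane

variable {η : ℝ → ℝ} {C : ℝ}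

theorem dirichletHalfPlane_of_pos (η : ℝ → ℝ) {z : ℂ} (hz : 0 < z.im) :
    dirichletHalfPlane η z = ∫ t, z.im / (Real.pi * ((z.re - t) ^ 2 + z.im ^ 2)) * η t :=
  if_pos hz

theorem dirichletHalfPlane_of_im_eq_zero (η : ℝ → ℝ) {z : ℂ} (hz : z.im = 0) :
    dirichletHalfPlane η z = η z.re :=
  if_neg hz.not_gt

/-- Unlike the Poisson kernel, the substitution `t = x + yτ` makes sense up to the boundary. -/
theorem dirichletHalfPlane_eq_integral_inv_one_add_sq (η : ℝ → ℝ) {z : ℂ} (hz : 0 ≤ z.im) :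
    dirichletHalfPlane η z = Real.pi⁻¹ * ∫ τ : ℝ, (1 + τ ^ 2)⁻¹ * η (z.re + z.im * τ) := by
  have hπ := Real.pi_ne_zero
  rcases hz.eq_or_lt with h | h
  · rw [dirichletHalfPlane_of_im_eq_zero η h.symm, ← h]
    simp only [zero_mul, add_zero]
    rw [integral_mul_const, integral_univ_inv_one_add_sq, inv_mul_cancel_left₀ hπ]
  · have hsubst : ∀ f : ℝ → ℝ, ∫ t, f t = z.im * ∫ τ, f (z.re + z.im * τ) := fun f => by
      rw [Measure.integral_comp_mul_left (fun t => f (z.re + t)) z.im, integral_add_left_eq_self f,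
        smul_eq_mul, abs_of_pos (inv_pos.2 h), mul_inv_cancel_left₀ h.ne']
    rw [dirichletHalfPlane_of_pos η h, hsubst, ← integral_const_mul, ← integral_const_mul]
    refine integral_congr_ae (Filter.Eventually.of_forall fun τ => ?_)
    have hτ : 1 + τ ^ 2 ≠ 0 := by positivity
    have hz0 := h.ne'
    have hdenom : (z.re - (z.re + z.im * τ)) ^ 2 + z.im ^ 2 = z.im ^ 2 * (1 + τ ^ 2) := by ring
    simp only [hdenom]
    field_simp

theorem norm_inv_one_add_sq_mul_le (hC : ∀ x, |η x| ≤ C) (τ x : ℝ) :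
    ‖(1 + τ ^ 2)⁻¹ * η x‖ ≤ (1 + τ ^ 2)⁻¹ * C := by
  have hτ : 0 ≤ (1 + τ ^ 2)⁻¹ := by positivity
  rw [norm_mul, Real.norm_of_nonneg hτ]
  exact mul_le_mul_of_nonneg_left (hC x) hτ

theorem abs_dirichletHalfPlane_le (hC : ∀ x, |η x| ≤ C) {z : ℂ} (hz : 0 ≤ z.im) :
    |dirichletHalfPlane η z| ≤ C := by
  have hint : |∫ τ : ℝ, (1 + τ ^ 2)⁻¹ * η (z.re + z.im * τ)| ≤ ∫ τ : ℝ, (1 + τ ^ 2)⁻¹ * C :=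
    norm_integral_le_of_norm_le (integrable_inv_one_add_sq.mul_const C)
      (Filter.Eventually.of_forall fun τ => norm_inv_one_add_sq_mul_le hC τ _)
  rw [integral_mul_const, integral_univ_inv_one_add_sq] at hint
  rw [dirichletHalfPlane_eq_integral_inv_one_add_sq η hz, abs_mul,
    abs_of_pos (inv_pos.2 Real.pi_pos)]
  exact (inv_mul_le_iff₀ Real.pi_pos).2 hint

theorem continuousWithinAt_dirichletHalfPlane_of_im_eq_zero (hm : Measurable η)
    (hC : ∀ x, |η x| ≤ C) {z : ℂ} (hz : z.im = 0) (hη : ContinuousAt η z.re) :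
    ContinuousWithinAt (dirichletHalfPlane η) {z | 0 ≤ z.im} z := by
  have hcont : ContinuousAt
      (fun z : ℂ => Real.pi⁻¹ * ∫ τ : ℝ, (1 + τ ^ 2)⁻¹ * η (z.re + z.im * τ)) z := by
    refine continuousAt_const.mul (continuousAt_of_dominated (bound := fun τ => (1 + τ ^ 2)⁻¹ * C)
      (Filter.Eventually.of_forall fun z => ?_)
      (Filter.Eventually.of_forall fun z => Filter.Eventually.of_forall fun τ =>
        norm_inv_one_add_sq_mul_le hC τ _)
      (integrable_inv_one_add_sq.mul_const C) (Filter.Eventually.of_forall fun τ => ?_))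
    · exact (Measurable.mul (by fun_prop) (hm.comp (by fun_prop))).aestronglyMeasurable
    · refine continuousAt_const.mul (ContinuousAt.comp (f := fun z : ℂ => z.re + z.im * τ) ?_
        (by fun_prop))
      simpa [hz] using hη
  exact hcont.continuousWithinAt.congr
    (fun y hy => dirichletHalfPlane_eq_integral_inv_one_add_sq η hy)
    (dirichletHalfPlane_eq_integral_inv_one_add_sq η hz.ge)

theorem ofReal_sub_ne_zero {z : ℂ} (hz : 0 < z.im) (t : ℝ) : (t : ℂ) - z ≠ 0 := fun h =>
  hz.ne' (by simpa using congrArg Complex.im h)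

theorem norm_inv_ofReal_sub_le {z : ℂ} {δ : ℝ} (hδ : 0 < δ) (hz : δ ≤ z.im) (t : ℝ) :
    ‖((t : ℂ) - z)⁻¹‖ ≤ δ⁻¹ := by
  rw [norm_inv]
  refine inv_anti₀ hδ (hz.trans ?_)
  simpa [abs_of_pos (hδ.trans_le hz)] using Complex.abs_im_le_norm ((t : ℂ) - z)

/-- The Nevanlinna kernel `(1 + t z) / (t - z)`, decomposed into partial fractions. Divided by
`1 + t²` it differs from `(t - z)⁻¹` by the real number `t / (1 + t²)`. -/
noncomputable def nevanlinnaKernel (z : ℂ) (t : ℝ) : ℂ := z + (1 + z ^ 2) * ((t : ℂ) - z)⁻¹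

/-- The holomorphic function on the upper half-plane whose imaginary part is `π` times the Poisson
extension of `η`. The Nevanlinna kernel replaces `(t - z)⁻¹` to make the integral converge. -/
noncomputable def poissonPotential (η : ℝ → ℝ) (z : ℂ) : ℂ :=
  ∫ t : ℝ, ((1 + t ^ 2)⁻¹ * η t : ℝ) * nevanlinnaKernel z t

theorem continuous_inv_ofReal_sub {z : ℂ} (hz : 0 < z.im) :
    Continuous fun t : ℝ => ((t : ℂ) - z)⁻¹ :=
  (Complex.continuous_ofReal.sub continuous_const).inv₀ (ofReal_sub_ne_zero hz)

theorem integrable_poissonPotential (hη : Integrable fun t => (1 + t ^ 2)⁻¹ * η t) {z : ℂ}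
    (hz : 0 < z.im) :
    Integrable fun t : ℝ => (((1 + t ^ 2)⁻¹ * η t : ℝ) : ℂ) * nevanlinnaKernel z t := by
  refine hη.ofReal.mul_bdd (c := ‖z‖ + ‖1 + z ^ 2‖ * z.im⁻¹) ?_
    (Filter.Eventually.of_forall fun t => ?_)
  · exact (continuous_const.add
      (continuous_const.mul (continuous_inv_ofReal_sub hz))).aestronglyMeasurable
  · refine (norm_add_le _ _).trans (add_le_add_right ?_ _)
    rw [norm_mul]
    exact mul_le_mul_of_nonneg_left (norm_inv_ofReal_sub_le hz le_rfl t) (norm_nonneg _)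

theorem hasDerivAt_nevanlinnaKernel {z : ℂ} (hz : 0 < z.im) (t : ℝ) :
    HasDerivAt (fun z => nevanlinnaKernel z t)
      (1 + 2 * z * ((t : ℂ) - z)⁻¹ + (1 + z ^ 2) * ((t : ℂ) - z)⁻¹ ^ 2) z := by
  have hinv : HasDerivAt (fun z : ℂ => ((t : ℂ) - z)⁻¹) (((t : ℂ) - z)⁻¹ ^ 2) z := by
    refine (((hasDerivAt_id z).const_sub (t : ℂ)).inv (ofReal_sub_ne_zero hz t)).congr_deriv ?_
    simp
  have hsq : HasDerivAt (fun z : ℂ => 1 + z ^ 2) (2 * z) z := by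
    simpa using (hasDerivAt_pow 2 z).const_add 1
  exact ((hasDerivAt_id z).add (hsq.mul hinv)).congr_deriv (by ring)

theorem norm_deriv_nevanlinnaKernel_le {z : ℂ} {δ R : ℝ} (hδ : 0 < δ) (hz : δ ≤ z.im)
    (hR : ‖z‖ ≤ R) (t : ℝ) :
    ‖1 + 2 * z * ((t : ℂ) - z)⁻¹ + (1 + z ^ 2) * ((t : ℂ) - z)⁻¹ ^ 2‖ ≤
      1 + 2 * R * δ⁻¹ + (1 + R ^ 2) * δ⁻¹ ^ 2 := by
  have hinv := norm_inv_ofReal_sub_le hδ hz t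
  have hR0 : 0 ≤ R := (norm_nonneg z).trans hR
  have hsq : ‖1 + z ^ 2‖ ≤ 1 + R ^ 2 := by
    refine (norm_add_le _ _).trans ?_
    rw [norm_one, norm_pow]
    gcongr
  refine (norm_add₃_le ..).trans ?_
  rw [norm_one, norm_mul, norm_mul, norm_mul, norm_pow, Complex.norm_two]
  gcongr

theorem half_im_le_and_norm_le_of_mem_ball {z x : ℂ} (hx : x ∈ Metric.ball z (z.im / 2)) :
    z.im / 2 ≤ x.im ∧ ‖x‖ ≤ ‖z‖ + z.im / 2 := by
  rw [Metric.mem_ball, dist_eq_norm] at hx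
  have him := (abs_le.1 ((Complex.abs_im_le_norm (x - z)).trans hx.le)).1
  rw [Complex.sub_im] at him
  exact ⟨by linarith, by linarith [norm_le_norm_add_norm_sub' x z]⟩

theorem differentiableAt_poissonPotential (hη : Integrable fun t => (1 + t ^ 2)⁻¹ * η t) {z : ℂ}
    (hz : 0 < z.im) : DifferentiableAt ℂ (poissonPotential η) z := by
  have hhalf : 0 < z.im / 2 := half_pos hz
  refine (hasDerivAt_integral_of_dominated_loc_of_deriv_le (μ := volume)
    (F := fun z t => (((1 + t ^ 2)⁻¹ * η t : ℝ) : ℂ) * nevanlinnaKernel z t)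
    (F' := fun (z : ℂ) (t : ℝ) => (((1 + t ^ 2)⁻¹ * η t : ℝ) : ℂ) *
      (1 + 2 * z * ((t : ℂ) - z)⁻¹ + (1 + z ^ 2) * ((t : ℂ) - z)⁻¹ ^ 2))
    (bound := fun t => ‖(1 + t ^ 2)⁻¹ * η t‖ * (1 + 2 * (‖z‖ + z.im / 2) * (z.im / 2)⁻¹ +
      (1 + (‖z‖ + z.im / 2) ^ 2) * (z.im / 2)⁻¹ ^ 2))
    (Metric.ball_mem_nhds z hhalf) ?_ (integrable_poissonPotential hη hz) ?_
    (Filter.Eventually.of_forall fun t x hx => ?_) (hη.norm.mul_const _)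
    (Filter.Eventually.of_forall fun t x hx => ?_)).2.differentiableAt
  · filter_upwards [Metric.ball_mem_nhds z hhalf] with x hx
    exact (integrable_poissonPotential hη
      (hhalf.trans_le (half_im_le_and_norm_le_of_mem_ball hx).1)).aestronglyMeasurable
  · have := continuous_inv_ofReal_sub hz
    exact hη.ofReal.aestronglyMeasurable.mul (by fun_prop : Continuous _).aestronglyMeasurable
  · obtain ⟨him, hnorm⟩ := half_im_le_and_norm_le_of_mem_ball hx
    rw [norm_mul, Complex.norm_real]
    exact mul_le_mul_of_nonneg_left (norm_deriv_nevanlinnaKernel_le hhalf him hnorm t)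
      (norm_nonneg _)
  · exact (hasDerivAt_nevanlinnaKernel
      (hhalf.trans_le (half_im_le_and_norm_le_of_mem_ball hx).1) t).const_mul _

theorem im_nevanlinnaKernel {z : ℂ} (hz : 0 < z.im) (t : ℝ) :
    (nevanlinnaKernel z t).im = (1 + t ^ 2) * (z.im / ((z.re - t) ^ 2 + z.im ^ 2)) := by
  have hkernel : nevanlinnaKernel z t = ((1 + t ^ 2 : ℝ) : ℂ) * ((t : ℂ) - z)⁻¹ - (t : ℝ) := by
    have := ofReal_sub_ne_zero hz t
    rw [nevanlinnaKernel]
    push_cast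
    field_simp
    ring
  rw [hkernel, Complex.sub_im, Complex.im_ofReal_mul, Complex.ofReal_im, sub_zero, Complex.inv_im,
    Complex.normSq_apply]
  simp only [Complex.sub_re, Complex.ofReal_re, Complex.sub_im, Complex.ofReal_im, zero_sub,
    neg_neg]
  congr 2
  ring

theorem poissonKernel_mul_eq_im {z : ℂ} (hz : 0 < z.im) (t : ℝ) :
    z.im / (Real.pi * ((z.re - t) ^ 2 + z.im ^ 2)) * η t =
      Real.pi⁻¹ * ((((1 + t ^ 2)⁻¹ * η t : ℝ) : ℂ) * nevanlinnaKernel z t).im := by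
  have ht : 1 + t ^ 2 ≠ 0 := by positivity
  rw [Complex.im_ofReal_mul, im_nevanlinnaKernel hz]
  have := Real.pi_ne_zero
  field_simp

theorem integrable_poissonKernel_mul (hη : Integrable fun t => (1 + t ^ 2)⁻¹ * η t) {z : ℂ}
    (hz : 0 < z.im) :
    Integrable fun t => z.im / (Real.pi * ((z.re - t) ^ 2 + z.im ^ 2)) * η t := by
  simp only [poissonKernel_mul_eq_im hz]
  exact (integrable_poissonPotential hη hz).im.const_mul _

theorem dirichletHalfPlane_eq_im_poissonPotential
    (hη : Integrable fun t => (1 + t ^ 2)⁻¹ * η t) {z : ℂ} (hz : 0 < z.im) :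
    dirichletHalfPlane η z = Real.pi⁻¹ * (poissonPotential η z).im := by
  simp only [dirichletHalfPlane_of_pos η hz, poissonKernel_mul_eq_im hz]
  rw [integral_const_mul]
  exact congrArg _ (Complex.imCLM.integral_comp_comm (integrable_poissonPotential hη hz))

theorem harmonicOnNhd_dirichletHalfPlane (hη : Integrable fun t => (1 + t ^ 2)⁻¹ * η t) :
    HarmonicOnNhd (dirichletHalfPlane η) {z | 0 < z.im} := by
  intro z hz
  have hopen : IsOpen {z : ℂ | 0 < z.im} := isOpen_lt continuous_const Complex.continuous_im
  have hanalytic : AnalyticAt ℂ (poissonPotential η) z :=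
    DifferentiableOn.analyticAt (s := {z : ℂ | 0 < z.im})
      (fun x hx => (differentiableAt_poissonPotential hη hx).differentiableWithinAt)
      (hopen.mem_nhds hz)
  refine (harmonicAt_congr_nhds ?_).2 (hanalytic.harmonicAt_im.const_smul (c := Real.pi⁻¹))
  filter_upwards [hopen.mem_nhds hz] with x hx
  exact dirichletHalfPlane_eq_im_poissonPotential hη hx

theorem integrable_inv_one_add_sq_mul (hm : Measurable η) (hC : ∀ x, |η x| ≤ C) :
    Integrable fun t => (1 + t ^ 2)⁻¹ * η t :=
  integrable_inv_one_add_sq.mul_bdd hm.aestronglyMeasurable (Filter.Eventually.of_forall hC)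

theorem continuousWithinAt_dirichletHalfPlane (hm : Measurable η) (hC : ∀ x, |η x| ≤ C) {z : ℂ}
    (hz : 0 ≤ z.im) (hη : z.im = 0 → ContinuousAt η z.re) :
    ContinuousWithinAt (dirichletHalfPlane η) {z | 0 ≤ z.im} z := by
  rcases hz.eq_or_lt with h | h
  · exact continuousWithinAt_dirichletHalfPlane_of_im_eq_zero hm hC h.symm (hη h.symm)
  · exact (harmonicOnNhd_dirichletHalfPlane (integrable_inv_one_add_sq_mul hm hC) z
      h).1.continuousAt.continuousWithinAt

end HalfPlane

/-! ### Reflection in the unit circle -/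

section Inversion

variable {w : ℝ → ℝ} {C : ℝ}

theorem symmExtension_of_one_le (w : ℝ → ℝ) {x : ℝ} (hx : 1 ≤ |x|) : symmExtension w x = w x :=
  if_pos hx

theorem symmExtension_of_abs_lt_one (w : ℝ → ℝ) {x : ℝ} (hx : |x| < 1) (h0 : x ≠ 0) :
    symmExtension w x = w x⁻¹ := by
  rw [symmExtension, if_neg hx.not_ge, if_neg h0, one_div]

theorem symmExtension_inv (w : ℝ → ℝ) (x : ℝ) : symmExtension w x⁻¹ = symmExtension w x := by
  rcases eq_or_ne x 0 with rfl | h0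
  · rw [inv_zero]
  have hpos := abs_pos.2 h0
  rcases lt_trichotomy |x| 1 with h | h | h
  · rw [symmExtension_of_abs_lt_one w h h0,
      symmExtension_of_one_le w (abs_inv x ▸ (one_le_inv₀ hpos).2 h.le)]
  · rcases eq_or_eq_neg_of_abs_eq h with rfl | rfl <;> norm_num
  · rw [symmExtension_of_one_le w h.le, symmExtension_of_abs_lt_one w
      (abs_inv x ▸ inv_lt_one_of_one_lt₀ h) (inv_ne_zero h0), inv_inv]

theorem abs_symmExtension_le (hC : ∀ x, 1 ≤ |x| → |w x| ≤ C) (x : ℝ) : |symmExtension w x| ≤ C := by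
  rcases le_or_gt 1 |x| with h | h
  · exact symmExtension_of_one_le w h ▸ hC x h
  rcases eq_or_ne x 0 with rfl | h0
  · have h0 : symmExtension w 0 = 0 := by norm_num [symmExtension]
    rw [h0, abs_zero]
    exact (abs_nonneg (w 1)).trans (hC 1 abs_one.ge)
  · exact symmExtension_of_abs_lt_one w h h0 ▸
      hC _ (abs_inv x ▸ (one_le_inv₀ (abs_pos.2 h0)).2 h.le)

theorem one_le_abs_max_mul {x : ℝ} (hx : x ≠ 0) : 1 ≤ |max 1 (x ^ 2)⁻¹ * x| := by
  have hpos := abs_pos.2 hx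
  rw [abs_mul, abs_of_pos (zero_lt_one.trans_le (le_max_left ..))]
  rcases le_total 1 |x| with h | h
  · exact one_le_mul_of_one_le_of_one_le (le_max_left ..) h
  · refine le_trans ?_ (mul_le_mul_of_nonneg_right (le_max_right ..) hpos.le)
    rw [← sq_abs, pow_two, mul_inv, inv_mul_cancel_right₀ hpos.ne']
    exact (one_le_inv₀ hpos).2 h

theorem symmExtension_eq_comp_max_mul (w : ℝ → ℝ) {x : ℝ} (hx : x ≠ 0) :
    symmExtension w x = w (max 1 (x ^ 2)⁻¹ * x) := by
  have hsq : 0 < x ^ 2 := by positivity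
  rcases le_or_gt 1 |x| with h | h
  · rw [symmExtension_of_one_le w h,
      max_eq_left (inv_le_one_of_one_le₀ (one_le_sq_iff_one_le_abs x |>.2 h)), one_mul]
  · rw [symmExtension_of_abs_lt_one w h hx,
      max_eq_right ((one_le_inv₀ hsq).2 (sq_le_one_iff_abs_le_one x |>.2 h.le)), pow_two, mul_inv,
      inv_mul_cancel_right₀ hx]

theorem continuousOn_symmExtension (hw : ContinuousOn w (closure freeSurface)) :
    ContinuousOn (symmExtension w) {0}ᶜ := by
  rw [closure_freeSurface] at hw
  have hmax : ContinuousOn (fun x : ℝ => max 1 (x ^ 2)⁻¹ * x) {0}ᶜ :=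
    (continuousOn_const.sup ((continuous_pow 2).continuousOn.inv₀
      fun x hx => pow_ne_zero 2 hx)).mul continuousOn_id
  exact (hw.comp hmax fun x hx => one_le_abs_max_mul hx).congr
    fun x hx => symmExtension_eq_comp_max_mul w hx

theorem measurable_symmExtension (hw : ContinuousOn w (closure freeSurface)) :
    Measurable (symmExtension w) :=
  measurable_of_continuousOn_compl_singleton 0 (continuousOn_symmExtension hw)

theorem inv_image_freeSurface_ae_eq : Inv.inv '' freeSurface =ᵐ[volume] freeSurfaceᶜ := by
  have himage : Inv.inv '' freeSurface = freeSurfaceᶜ \ {0, 1, -1} := by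
    ext t
    rw [image_eq_preimage_of_inverse inv_inv inv_inv]
    simp only [freeSurface, mem_preimage, mem_ofPred_eq, abs_inv, one_lt_inv_iff₀, abs_pos,
      mem_sdiff, mem_compl_iff, not_lt, mem_insert_iff, mem_singleton_iff, not_or,
      lt_iff_le_and_ne (b := (1 : ℝ)), ne_eq, abs_eq zero_le_one]
    tauto
  rw [himage]
  exact sdiff_null_ae_eq_self ((toFinite _).measure_zero _)

theorem ne_zero_of_mem_freeSurface {t : ℝ} (ht : t ∈ freeSurface) : t ≠ 0 :=
  abs_pos.1 (zero_lt_one.trans ht)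

theorem integral_eq_setIntegral_freeSurface_add_inv {f : ℝ → ℝ} (hf : Integrable f) :
    ∫ t, f t = ∫ t in freeSurface, (f t + (t ^ 2)⁻¹ * f t⁻¹) := by
  have hmeas : MeasurableSet freeSurface := isOpen_freeSurface.measurableSet
  have hderiv : ∀ t ∈ freeSurface, HasDerivWithinAt Inv.inv (-(t ^ 2)⁻¹) freeSurface t :=
    fun t ht => (hasDerivAt_inv (ne_zero_of_mem_freeSurface ht)).hasDerivWithinAt
  have hinj : InjOn Inv.inv freeSurface := inv_injective.injOn
  have hjac : ∀ t : ℝ, |(-(t ^ 2)⁻¹)| = (t ^ 2)⁻¹ := fun t => by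
    rw [abs_neg, abs_of_nonneg (by positivity)]
  have hint := (integrableOn_image_iff_integrableOn_abs_deriv_smul hmeas hderiv hinj f).1
    hf.integrableOn
  have hsubst := integral_image_eq_integral_abs_deriv_smul hmeas hderiv hinj f
  simp only [hjac, smul_eq_mul] at hint hsubst
  rw [integral_add hf.integrableOn hint, ← hsubst,
    setIntegral_congr_set inv_image_freeSurface_ae_eq]
  exact (integral_add_compl hmeas hf).symm

theorem dirichletOmega_of_pos (w : ℝ → ℝ) {z : ℂ} (hz : 0 < z.im) :
    dirichletOmega w z = 1 / Real.pi * ∫ t in freeSurface,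
      (z.im / ((z.re - t) ^ 2 + z.im ^ 2) +
        z.im / ((z.re * t - 1) ^ 2 + z.im ^ 2 * t ^ 2)) * w t :=
  if_pos hz

theorem dirichletOmega_of_im_eq_zero (w : ℝ → ℝ) {z : ℂ} (hz : z.im = 0) :
    dirichletOmega w z = w z.re :=
  if_neg hz.not_gt

theorem dirichletOmega_eq_dirichletHalfPlane (hw : ContinuousOn w (closure freeSurface))
    (hC : ∀ x, 1 ≤ |x| → |w x| ≤ C) {z : ℂ} (hz : 0 < z.im) :
    dirichletOmega w z = dirichletHalfPlane (symmExtension w) z := by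
  have hη := integrable_inv_one_add_sq_mul (measurable_symmExtension hw) (abs_symmExtension_le hC)
  rw [dirichletHalfPlane_of_pos _ hz,
    integral_eq_setIntegral_freeSurface_add_inv (integrable_poissonKernel_mul hη hz),
    dirichletOmega_of_pos w hz, ← integral_const_mul]
  refine setIntegral_congr_fun isOpen_freeSurface.measurableSet fun t ht => ?_
  have ht0 := ne_zero_of_mem_freeSurface ht
  have hπ := Real.pi_ne_zero
  have hfold : (z.re - t⁻¹) ^ 2 + z.im ^ 2 =
      ((z.re * t - 1) ^ 2 + z.im ^ 2 * t ^ 2) * (t ^ 2)⁻¹ := by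
    field_simp
  have hne₁ : (z.re - t) ^ 2 + z.im ^ 2 ≠ 0 := by positivity
  have hne₂ : (z.re * t - 1) ^ 2 + z.im ^ 2 * t ^ 2 ≠ 0 := by positivity
  simp only [hfold, symmExtension_inv, symmExtension_of_one_le w (le_of_lt ht)]
  field_simp

theorem dirichletOmega_inversion (w : ℝ → ℝ) {x y : ℝ} (hy : 0 < y) :
    dirichletOmega w ⟨x / (x ^ 2 + y ^ 2), y / (x ^ 2 + y ^ 2)⟩ = dirichletOmega w ⟨x, y⟩ := by
  have hr : x ^ 2 + y ^ 2 ≠ 0 := by positivity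
  rw [dirichletOmega_of_pos w (div_pos hy (by positivity : 0 < x ^ 2 + y ^ 2)),
    dirichletOmega_of_pos w hy]
  refine congrArg _ (setIntegral_congr_fun isOpen_freeSurface.measurableSet fun t _ => ?_)
  have hfirst : (x / (x ^ 2 + y ^ 2) - t) ^ 2 + (y / (x ^ 2 + y ^ 2)) ^ 2 =
      ((x * t - 1) ^ 2 + y ^ 2 * t ^ 2) / (x ^ 2 + y ^ 2) := by field_simp; ring
  have hsecond : (x / (x ^ 2 + y ^ 2) * t - 1) ^ 2 + (y / (x ^ 2 + y ^ 2)) ^ 2 * t ^ 2 =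
      ((x - t) ^ 2 + y ^ 2) / (x ^ 2 + y ^ 2) := by field_simp; ring
  simp only [hfirst, hsecond, div_div_div_cancel_right₀ hr]
  rw [add_comm]

theorem dirichletHalfPlane_symmExtension_eq_dirichletOmega_inversion
    (hw : ContinuousOn w (closure freeSurface)) (hC : ∀ x, 1 ≤ |x| → |w x| ≤ C) {x y : ℝ}
    (hy : 0 ≤ y) (hpos : 0 < x ^ 2 + y ^ 2) (hlt : x ^ 2 + y ^ 2 < 1) :
    dirichletHalfPlane (symmExtension w) ⟨x, y⟩ =
      dirichletOmega w ⟨x / (x ^ 2 + y ^ 2), y / (x ^ 2 + y ^ 2)⟩ := by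
  rcases hy.eq_or_lt with rfl | hy
  · simp only [zero_pow two_ne_zero, add_zero] at hpos hlt ⊢
    have hx0 : x ≠ 0 := (pow_ne_zero_iff two_ne_zero).1 hpos.ne'
    rw [dirichletHalfPlane_of_im_eq_zero _ rfl, dirichletOmega_of_im_eq_zero _ (zero_div _),
      symmExtension_of_abs_lt_one w ((sq_lt_one_iff_abs_lt_one x).1 hlt) hx0, pow_two,
      div_mul_cancel_left₀ hx0]
  · rw [dirichletOmega_inversion w hy]
    exact (dirichletOmega_eq_dirichletHalfPlane hw hC hy).symm

end Inversion

/-! ### The fluid domain in logarithmic polar coordinates -/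

theorem re_sq_add_im_sq_eq_norm_sq (z : ℂ) : z.re ^ 2 + z.im ^ 2 = ‖z‖ ^ 2 := by
  rw [Complex.sq_norm, Complex.normSq_apply, pow_two, pow_two]

theorem mem_fluidDomain {z : ℂ} : z ∈ fluidDomain ↔ 1 < ‖z‖ ∧ 0 < z.im := by
  rw [fluidDomain, mem_ofPred_eq, re_sq_add_im_sq_eq_norm_sq, one_lt_sq_iff₀ (norm_nonneg z)]

theorem mem_halfCircle {z : ℂ} : z ∈ halfCircle ↔ ‖z‖ = 1 ∧ 0 < z.im := by
  rw [halfCircle, mem_ofPred_eq, re_sq_add_im_sq_eq_norm_sq,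
    pow_eq_one_iff_of_nonneg (norm_nonneg z) two_ne_zero]

theorem exp_mem_fluidDomain {ζ : ℂ} (hζ : ζ ∈ Ioi 0 ×ℂ Ioo 0 Real.pi) :
    Complex.exp ζ ∈ fluidDomain := by
  obtain ⟨hre, him⟩ := Complex.mem_reProdIm.1 hζ
  rw [mem_fluidDomain, Complex.norm_exp, Complex.exp_im]
  exact ⟨Real.one_lt_exp_iff.2 hre, mul_pos (Real.exp_pos _) (Real.sin_pos_of_mem_Ioo him)⟩

theorem exists_mem_strip_exp_eq {z : ℂ} (hnorm : 1 ≤ ‖z‖) (him : 0 ≤ z.im) :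
    ∃ ζ ∈ Ici 0 ×ℂ Icc 0 Real.pi, Complex.exp ζ = z := by
  refine ⟨Complex.log z, Complex.mem_reProdIm.2 ⟨?_, ?_⟩,
    Complex.exp_log (norm_pos_iff.1 (zero_lt_one.trans_le hnorm))⟩
  · exact Complex.log_re z ▸ Real.log_nonneg hnorm
  · exact Complex.log_im z ▸ ⟨Complex.arg_nonneg_iff.2 him, Complex.arg_le_pi z⟩

theorem exp_mem_closure_fluidDomain {ζ : ℂ} (hζ : ζ ∈ Ici 0 ×ℂ Icc 0 Real.pi) :
    Complex.exp ζ ∈ closure fluidDomain := by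
  refine map_mem_closure Complex.continuous_exp ?_ fun ξ => exp_mem_fluidDomain
  rwa [Complex.closure_reProdIm, closure_Ioi, closure_Ioo Real.pi_pos.ne]

theorem mem_closure_fluidDomain {z : ℂ} : z ∈ closure fluidDomain ↔ 1 ≤ ‖z‖ ∧ 0 ≤ z.im := by
  refine ⟨fun hz => ?_, fun ⟨hnorm, him⟩ => ?_⟩
  · exact closure_minimal (t := {z : ℂ | 1 ≤ ‖z‖} ∩ {z | 0 ≤ z.im})
      (fun ξ hξ => ⟨(mem_fluidDomain.1 hξ).1.le, (mem_fluidDomain.1 hξ).2.le⟩)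
      ((isClosed_le continuous_const continuous_norm).inter
        (isClosed_le continuous_const Complex.continuous_im)) hz
  · obtain ⟨ζ, hζ, rfl⟩ := exists_mem_strip_exp_eq hnorm him
    exact exp_mem_closure_fluidDomain hζ

theorem image_exp_strip :
    Complex.exp '' (Ici 0 ×ℂ Icc 0 Real.pi) = closure fluidDomain := by
  refine (image_subset_iff.2 fun ζ => exp_mem_closure_fluidDomain).antisymm fun z hz => ?_
  exact exists_mem_strip_exp_eq (mem_closure_fluidDomain.1 hz).1 (mem_closure_fluidDomain.1 hz).2

theorem uniqueDiffOn_reProdIm {s t : Set ℝ} (hs : Convex ℝ s) (ht : Convex ℝ t)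
    (hs' : (interior s).Nonempty) (ht' : (interior t).Nonempty) : UniqueDiffOn ℝ (s ×ℂ t) := by
  refine uniqueDiffOn_convex
    ((hs.linear_preimage Complex.reLm).inter (ht.linear_preimage Complex.imLm)) ?_
  obtain ⟨⟨x, hx⟩, y, hy⟩ := hs', ht'
  exact Complex.interior_reProdIm s t ▸ ⟨⟨x, y⟩, hx, hy⟩

theorem uniqueDiffOn_closure_fluidDomain : UniqueDiffOn ℝ (closure fluidDomain) := by
  rw [← image_exp_strip]
  refine (uniqueDiffOn_reProdIm (convex_Ici 0) (convex_Icc 0 Real.pi)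
    (by simp) (by simp [Real.pi_pos])).image
    (fun ζ _ => ((Complex.hasDerivAt_exp ζ).hasFDerivAt.restrictScalars ℝ).hasFDerivWithinAt)
    fun ζ _ => Function.Surjective.denseRange fun z => ⟨z / Complex.exp ζ, ?_⟩
  simp [Complex.exp_ne_zero]

theorem polar_eq_ofReal_mul_exp (r θ : ℝ) :
    (⟨r * Real.cos θ, r * Real.sin θ⟩ : ℂ) = r * Complex.exp (θ * Complex.I) := by
  apply Complex.ext <;> simp [Complex.exp_ofReal_mul_I_re, Complex.exp_ofReal_mul_I_im]

theorem exp_ofReal_mul_I_im_pos {θ : ℝ} (hθ : θ ∈ Ioo 0 Real.pi) :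
    0 < (Complex.exp (θ * Complex.I)).im :=
  Complex.exp_ofReal_mul_I_im θ ▸ Real.sin_pos_of_mem_Ioo hθ

theorem exp_ofReal_mul_I_mem_halfCircle {θ : ℝ} (hθ : θ ∈ Ioo 0 Real.pi) :
    Complex.exp (θ * Complex.I) ∈ halfCircle :=
  mem_halfCircle.2 ⟨Complex.norm_exp_ofReal_mul_I θ, exp_ofReal_mul_I_im_pos hθ⟩

theorem radialDeriv_of_mem_halfCircle (ψ : ℂ → ℝ) {z : ℂ} (hz : z ∈ halfCircle) :
    radialDeriv ψ z = fderivWithin ℝ ψ (closure fluidDomain) z z := by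
  have hsum : z.re • (1 : ℂ) + z.im • Complex.I = z := by simp [Complex.re_add_im]
  conv_rhs => arg 2; rw [← hsum]
  rw [map_add, map_smul, map_smul, radialDeriv, hz.1, Real.sqrt_one, div_one, div_one, smul_eq_mul,
    smul_eq_mul]

/-! ### The explicit formula solves the mixed problem -/

theorem eq_zero_of_hasDerivAt_one_of_eventuallyEq_comp_inv {f : ℝ → ℝ} {f' : ℝ}
    (hf : HasDerivAt f f' 1) (hinv : (fun r => f r⁻¹) =ᶠ[nhds 1] f) : f' = 0 := by
  have hcomp : HasDerivAt (fun r => f r⁻¹) (f' * -1) 1 := by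
    refine HasDerivAt.comp (1 : ℝ) (h := Inv.inv) (by rwa [inv_one]) ?_
    simpa using hasDerivAt_inv (one_ne_zero (α := ℝ))
  linarith [hf.unique (hcomp.congr_of_eventuallyEq hinv.symm)]

theorem hasDerivAt_comp_ofReal_mul {E : Type*} [NormedAddCommGroup E] [NormedSpace ℝ E] {ψ : ℂ → E}
    {L : ℂ →L[ℝ] E} {r : ℝ} {z : ℂ} (hψ : HasFDerivAt ψ L (r * z)) :
    HasDerivAt (fun r : ℝ => ψ (r * z)) (L z) r := by
  refine hψ.comp_hasDerivAt r ?_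
  simpa using (Complex.ofRealCLM.hasDerivAt (x := r)).mul_const z

theorem hasDerivAt_setIntegral_of_isCompact {α E : Type*} [TopologicalSpace α] [T2Space α]
    [MeasurableSpace α] [OpensMeasurableSpace α] {μ : Measure α} [IsFiniteMeasureOnCompacts μ]
    [NormedAddCommGroup E] [NormedSpace ℝ E] {F F' : ℝ → α → E} {s : Set ℝ} {K : Set α} {x₀ : ℝ}
    (hs : IsCompact s) (hK : IsCompact K) (hx₀ : s ∈ nhds x₀) (hF : ∀ x ∈ s, ContinuousOn (F x) K)
    (hF' : ContinuousOn (fun p : ℝ × α => F' p.1 p.2) (s ×ˢ K))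
    (hderiv : ∀ t ∈ K, ∀ x ∈ s, HasDerivAt (fun x => F x t) (F' x t) x) :
    HasDerivAt (fun x => ∫ t in K, F x t ∂μ) (∫ t in K, F' x₀ t ∂μ) x₀ := by
  obtain ⟨B, hB⟩ := (hs.prod hK).exists_bound_of_continuousOn hF'
  have hF'x₀ : ContinuousOn (F' x₀) K :=
    hF'.comp (f := fun t => (x₀, t)) (by fun_prop) fun t ht => ⟨mem_of_mem_nhds hx₀, ht⟩
  refine (hasDerivAt_integral_of_dominated_loc_of_deriv_le hx₀ ?_
    ((hF x₀ (mem_of_mem_nhds hx₀)).integrableOn_compact hK) ?_ ?_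
    (integrableOn_const (C := B) hK.measure_ne_top) ?_).2
  · filter_upwards [hx₀] with x hx
    exact (hF x hx).aestronglyMeasurable_of_isCompact hK hK.measurableSet
  · exact hF'x₀.aestronglyMeasurable_of_isCompact hK hK.measurableSet
  · exact ae_restrict_of_forall_mem hK.measurableSet fun t ht x hx => hB (x, t) ⟨hx, ht⟩
  · exact ae_restrict_of_forall_mem hK.measurableSet hderiv

theorem IsTestFunction.intervalIntegral_mul_eq {φ : ℝ → ℝ} {a b : ℝ}
    (hφ : IsTestFunction (Ioo a b) φ) (hab : a ≤ b) (f : ℝ → ℝ) :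
    ∫ θ in a..b, f θ * φ θ = ∫ θ in tsupport φ, f θ * φ θ := by
  rw [intervalIntegral.integral_of_le hab]
  refine setIntegral_eq_of_subset_of_forall_sdiff_eq_zero measurableSet_Ioc
    (hφ.tsupport_subset.trans Ioo_subset_Ioc_self) fun θ hθ => ?_
  rw [image_eq_zero_of_notMem_tsupport hθ.2, mul_zero]

theorem isOpen_im_pos : IsOpen {z : ℂ | 0 < z.im} :=
  isOpen_lt continuous_const Complex.continuous_im

/-- Test functions of the angle have compact support in `(0, π)`, which keeps the rays involved
away from the real axis. -/
theorem differentiableAt_integral_ray {ψ : ℂ → ℝ} (hψ : ContDiffOn ℝ 1 ψ {z | 0 < z.im})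
    {φ : ℝ → ℝ} (hφ : IsTestFunction (Ioo 0 Real.pi) φ) :
    DifferentiableAt ℝ (fun r : ℝ => ∫ θ in (0 : ℝ)..Real.pi,
      ψ ⟨r * Real.cos θ, r * Real.sin θ⟩ * φ θ) 1 := by
  simp only [hφ.intervalIntegral_mul_eq Real.pi_pos.le, polar_eq_ofReal_mul_exp]
  have hφc : Continuous φ := hφ.contDiff.continuous
  have hmem : ∀ r ∈ Icc (1 / 2 : ℝ) 2, ∀ θ ∈ tsupport φ,
      0 < ((r : ℂ) * Complex.exp (θ * Complex.I)).im := fun r hr θ hθ => by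
    rw [Complex.im_ofReal_mul]
    exact mul_pos (by linarith [hr.1]) (exp_ofReal_mul_I_im_pos (hφ.tsupport_subset hθ))
  have hderiv : ContinuousOn (fderiv ℝ ψ) {z | 0 < z.im} :=
    hψ.continuousOn_fderiv_of_isOpen isOpen_im_pos le_rfl
  refine (hasDerivAt_setIntegral_of_isCompact (s := Icc (1 / 2) 2)
    (F' := fun r (θ : ℝ) =>
      fderiv ℝ ψ (r * Complex.exp (θ * Complex.I)) (Complex.exp (θ * Complex.I)) * φ θ)
    (x₀ := 1) isCompact_Icc hφ.hasCompactSupport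
    (Icc_mem_nhds (by norm_num) (by norm_num)) (fun r hr => ?_) ?_
    fun θ hθ r hr => ?_).differentiableAt
  · exact (hψ.continuousOn.comp (by fun_prop) (hmem r hr)).mul hφc.continuousOn
  · exact ((hderiv.comp (by fun_prop) fun p hp => hmem p.1 hp.1 p.2 hp.2).clm_apply
      (by fun_prop)).mul (by fun_prop)
  · refine (hasDerivAt_comp_ofReal_mul ?_).mul_const (φ θ)
    exact ((hψ.differentiableOn one_ne_zero).differentiableAt
      (isOpen_im_pos.mem_nhds (hmem r hr θ hθ))).hasFDerivAt

section Existence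

variable {w : ℝ → ℝ} {C : ℝ}

theorem eqOn_dirichletOmega_dirichletHalfPlane (hw : ContinuousOn w (closure freeSurface))
    (hC : ∀ x, 1 ≤ |x| → |w x| ≤ C) :
    EqOn (dirichletOmega w) (dirichletHalfPlane (symmExtension w)) (closure fluidDomain) := by
  intro z hz
  obtain ⟨hnorm, him⟩ := mem_closure_fluidDomain.1 hz
  rcases him.eq_or_lt with h0 | hpos
  · rw [dirichletOmega_of_im_eq_zero w h0.symm, dirichletHalfPlane_of_im_eq_zero _ h0.symm,
      symmExtension_of_one_le w (Complex.abs_re_eq_norm.2 h0.symm ▸ hnorm)]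
  · exact dirichletOmega_eq_dirichletHalfPlane hw hC hpos

theorem continuousBounded_dirichletOmega (hw : ContinuousOn w (closure freeSurface))
    (hC : ∀ x, 1 ≤ |x| → |w x| ≤ C) : ContinuousBounded (dirichletOmega w) := by
  have heq := eqOn_dirichletOmega_dirichletHalfPlane hw hC
  refine ⟨ContinuousOn.congr (fun z hz => ?_) heq, C, fun z hz => ?_⟩
  · obtain ⟨hnorm, him⟩ := mem_closure_fluidDomain.1 hz
    refine (continuousWithinAt_dirichletHalfPlane (measurable_symmExtension hw)
      (abs_symmExtension_le hC) him fun h0 => ?_).mono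
      fun y hy => (mem_closure_fluidDomain.1 hy).2
    have hre : z.re ≠ 0 := abs_pos.1 (zero_lt_one.trans_le (Complex.abs_re_eq_norm.2 h0 ▸ hnorm))
    exact (continuousOn_symmExtension hw).continuousAt (isOpen_compl_singleton.mem_nhds hre)
  · rw [heq hz]
    exact abs_dirichletHalfPlane_le (abs_symmExtension_le hC) (mem_closure_fluidDomain.1 hz).2

theorem harmonicOnNhd_dirichletOmega (hw : ContinuousOn w (closure freeSurface))
    (hC : ∀ x, 1 ≤ |x| → |w x| ≤ C) : HarmonicOnNhd (dirichletOmega w) {z | 0 < z.im} := by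
  have hη := integrable_inv_one_add_sq_mul (measurable_symmExtension hw) (abs_symmExtension_le hC)
  refine fun z hz => (harmonicAt_congr_nhds ?_).2 (harmonicOnNhd_dirichletHalfPlane hη z hz)
  filter_upwards [isOpen_im_pos.mem_nhds hz] with y hy
  exact dirichletOmega_eq_dirichletHalfPlane hw hC hy

theorem dirichletOmega_inv_mul (w : ℝ → ℝ) {r : ℝ} (hr : 0 < r) {z : ℂ} (hz : z ∈ halfCircle) :
    dirichletOmega w ((r⁻¹ : ℝ) * z) = dirichletOmega w (r * z) := by
  have hsq : (r * z.re) ^ 2 + (r * z.im) ^ 2 = r ^ 2 := by linear_combination r ^ 2 * hz.1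
  have hinv : (⟨r * z.re / r ^ 2, r * z.im / r ^ 2⟩ : ℂ) = (r⁻¹ : ℝ) * z := by
    apply Complex.ext <;> simp only [Complex.re_ofReal_mul, Complex.im_ofReal_mul] <;> field_simp
  have hmul : (⟨r * z.re, r * z.im⟩ : ℂ) = r * z := by
    apply Complex.ext <;> simp only [Complex.re_ofReal_mul, Complex.im_ofReal_mul]
  rw [← hinv, ← hmul, ← dirichletOmega_inversion w (mul_pos hr hz.2), hsq]

theorem classicalNeumann_dirichletOmega (hw : ContinuousOn w (closure freeSurface))
    (hC : ∀ x, 1 ≤ |x| → |w x| ≤ C) : ClassicalNeumann (dirichletOmega w) := by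
  intro z hz
  have hdiff : DifferentiableAt ℝ (dirichletOmega w) z :=
    (harmonicOnNhd_dirichletOmega hw hC z hz.2).1.differentiableAt two_ne_zero
  refine ⟨hdiff.differentiableWithinAt, ?_⟩
  have hmem : z ∈ closure fluidDomain :=
    mem_closure_fluidDomain.2 ⟨(mem_halfCircle.1 hz).1.ge, hz.2.le⟩
  rw [radialDeriv_of_mem_halfCircle _ hz,
    hdiff.fderivWithin (uniqueDiffOn_closure_fluidDomain z hmem)]
  refine eq_zero_of_hasDerivAt_one_of_eventuallyEq_comp_inv
    (hasDerivAt_comp_ofReal_mul (by simpa using hdiff.hasFDerivAt)) ?_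
  filter_upwards [Ioi_mem_nhds zero_lt_one] with r hr
  exact dirichletOmega_inv_mul w hr hz

theorem weakNeumann_dirichletOmega (hw : ContinuousOn w (closure freeSurface))
    (hC : ∀ x, 1 ≤ |x| → |w x| ≤ C) : WeakNeumann (dirichletOmega w) := by
  intro φ hφ hφc hφt
  have hφ : IsTestFunction (Ioo 0 Real.pi) φ := ⟨hφ, hφc, hφt⟩
  have hdiff := differentiableAt_integral_ray
    ((harmonicOnNhd_dirichletOmega hw hC).contDiffOn.of_le one_le_two) hφ
  refine (eq_zero_of_hasDerivAt_one_of_eventuallyEq_comp_inv hdiff.hasDerivAt ?_ ▸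
    hdiff.hasDerivAt).hasDerivWithinAt
  filter_upwards [Ioi_mem_nhds zero_lt_one] with r hr
  simp only [hφ.intervalIntegral_mul_eq Real.pi_pos.le, polar_eq_ofReal_mul_exp]
  refine setIntegral_congr_fun hφc.measurableSet fun θ hθ => ?_
  rw [dirichletOmega_inv_mul w hr (exp_ofReal_mul_I_mem_halfCircle (hφt hθ))]

theorem dirichletOmega_ofReal (w : ℝ → ℝ) (x : ℝ) : dirichletOmega w x = w x := by
  rw [dirichletOmega_of_im_eq_zero w (Complex.ofReal_im x), Complex.ofReal_re]

theorem isClassicalSolution_dirichletOmega (hw : ContinuousOn w (closure freeSurface))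
    (hC : ∀ x, 1 ≤ |x| → |w x| ≤ C) : IsClassicalSolution w (dirichletOmega w) where
  continuousBounded := continuousBounded_dirichletOmega hw hC
  harmonic := (harmonicOnNhd_dirichletOmega hw hC).mono fun _ hz => hz.2
  neumann := classicalNeumann_dirichletOmega hw hC
  trace x _ := dirichletOmega_ofReal w x

theorem isWeakSolution_dirichletOmega (hw : ContinuousOn w (closure freeSurface))
    (hC : ∀ x, 1 ≤ |x| → |w x| ≤ C) : IsWeakSolution w (dirichletOmega w) where
  continuousBounded := continuousBounded_dirichletOmega hw hC
  harmonic := (harmonicOnNhd_dirichletOmega hw hC).mono fun _ hz => hz.2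
  neumann := weakNeumann_dirichletOmega hw hC
  trace x _ := dirichletOmega_ofReal w x

end Existence

/-! ### The maximum principle in a half-strip -/

/-- The mean value property of `g` on all circles whose closed disc lies in `U`. For a continuous
function it is equivalent to harmonicity, but it is more easily seen to survive averaging over
translations. -/
def MeanValueOn (g : ℂ → ℝ) (U : Set ℂ) : Prop :=
  ∀ ζ R, 0 < R → Metric.closedBall ζ R ⊆ U → Real.circleAverage g ζ R = g ζ

theorem meanValueOn_of_harmonicOnNhd {g : ℂ → ℝ} {U : Set ℂ} (hg : HarmonicOnNhd g U) :
    MeanValueOn g U := fun _ _ hR hball =>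
  InnerProductSpace.HarmonicOnNhd.circleAverage_eq (hg.mono (by rwa [abs_of_pos hR]))

theorem circleAverage_lt_of_le_of_exists_lt {g : ℂ → ℝ} {c z : ℂ} {R M : ℝ}
    (hg : ContinuousOn g (Metric.sphere c |R|)) (hle : ∀ ξ ∈ Metric.sphere c |R|, g ξ ≤ M)
    (hz : z ∈ Metric.sphere c |R|) (hlt : g z < M) : Real.circleAverage g c R < M := by
  obtain ⟨θ, hθ, rfl⟩ := image_circleMap_Ioc c R ▸ hz
  have h := intervalIntegral.integral_lt_integral_of_continuousOn_of_le_of_exists_lt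
    Real.two_pi_pos (f := fun θ => g (circleMap c R θ)) (g := fun _ => M)
    (hg.comp (continuous_circleMap c R).continuousOn fun θ _ => circleMap_mem_sphere' c R θ)
    continuousOn_const (fun θ _ => hle _ (circleMap_mem_sphere' c R θ))
    ⟨θ, Ioc_subset_Icc_self hθ, hlt⟩
  rw [intervalIntegral.integral_const, sub_zero, smul_eq_mul] at h
  rwa [Real.circleAverage_def, smul_eq_mul, inv_mul_lt_iff₀ Real.two_pi_pos]

namespace MeanValueOn

variable {g h : ℂ → ℝ} {U V : Set ℂ}

theorem mono (hg : MeanValueOn g U) (hVU : V ⊆ U) : MeanValueOn g V :=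
  fun ζ R hR hball => hg ζ R hR (hball.trans hVU)

theorem congr (hg : MeanValueOn g U) (heq : EqOn h g U) : MeanValueOn h U := by
  intro ζ R hR hball
  rw [heq (hball (Metric.mem_closedBall_self hR.le)), ← hg ζ R hR hball]
  refine Real.circleAverage_congr_sphere (heq.mono ?_)
  rw [abs_of_pos hR]
  exact Metric.sphere_subset_closedBall.trans hball

theorem sub (hg : MeanValueOn g U) (hh : MeanValueOn h U) (hgc : ContinuousOn g U)
    (hhc : ContinuousOn h U) : MeanValueOn (g - h) U := by
  intro ζ R hR hball
  have hsphere : Metric.sphere ζ |R| ⊆ U := by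
    rw [abs_of_pos hR]
    exact Metric.sphere_subset_closedBall.trans hball
  rw [Real.circleAverage_sub (hgc.mono hsphere).circleIntegrable'
    (hhc.mono hsphere).circleIntegrable', hg ζ R hR hball, hh ζ R hR hball, Pi.sub_apply]

theorem const_smul (hg : MeanValueOn g U) (c : ℝ) : MeanValueOn (c • g) U := by
  intro ζ R hR hball
  rw [Real.circleAverage_smul, hg ζ R hR hball, Pi.smul_apply]

/-- A maximum point of least imaginary part cannot lie in `U`: the function would be equal to its
maximum on a circle around it. -/
theorem exists_isMaxOn_mem_diff {K : Set ℂ} (hg : MeanValueOn g U) (hU : IsOpen U) (hUK : U ⊆ K)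
    (hK : IsCompact K) (hne : K.Nonempty) (hc : ContinuousOn g K) :
    ∃ ζ ∈ K \ U, IsMaxOn g K ζ := by
  obtain ⟨ζ₁, hζ₁, hmax⟩ := hK.exists_isMaxOn hne hc
  obtain ⟨ζ, ⟨hζK, hζ⟩, hmin⟩ :=
    (hK.of_isClosed_subset (hc.preimage_isClosed_of_isClosed hK.isClosed isClosed_singleton)
      inter_subset_left).exists_isMinOn ⟨ζ₁, hζ₁, mem_singleton (g ζ₁)⟩
      Complex.continuous_im.continuousOn
  replace hζ : g ζ = g ζ₁ := hζ
  refine ⟨ζ, ⟨hζK, fun hζU => ?_⟩, fun ξ hξ => (hmax hξ).trans hζ.ge⟩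
  obtain ⟨R, hR, hball⟩ := Metric.nhds_basis_closedBall.mem_iff.1 (hU.mem_nhds hζU)
  have hsphere : Metric.sphere ζ |R| ⊆ K := by
    rw [abs_of_pos hR]
    exact (Metric.sphere_subset_closedBall.trans hball).trans hUK
  have hbottom : ζ - R * Complex.I ∈ Metric.sphere ζ |R| := by simp
  have hlt : g (ζ - R * Complex.I) < g ζ₁ := by
    refine lt_of_le_of_ne (hmax (hsphere hbottom)) fun heq => ?_
    have him : ζ.im ≤ (ζ - R * Complex.I).im := hmin ⟨hsphere hbottom, heq⟩
    simp only [Complex.sub_im, Complex.im_ofReal_mul, Complex.I_im] at him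
    linarith
  exact (circleAverage_lt_of_le_of_exists_lt (hc.mono hsphere)
    (fun ξ hξ => hmax (hsphere hξ)) hbottom hlt).ne ((hg ζ R hR hball).trans hζ)

end MeanValueOn

/-- A positive harmonic function in the strip `0 ≤ θ ≤ π`, `ζ = s + i θ`, that tends to infinity
with `s` and is strictly decreasing in `s` at the edge `s = 0`. -/
noncomputable def stripBarrier (ζ : ℂ) : ℝ :=
  (Real.exp (ζ.re / 2) + 2 * Real.exp (-(ζ.re / 2))) * Real.cos ((ζ.im - Real.pi / 2) / 2)

theorem harmonicAt_stripBarrier (ζ : ℂ) : HarmonicAt stripBarrier ζ := by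
  let f : ℂ → ℂ := fun ζ => Complex.exp ((ζ - (Real.pi / 2 : ℝ) * Complex.I) / 2) +
    2 * Complex.exp (-((ζ - (Real.pi / 2 : ℝ) * Complex.I) / 2))
  have hf : stripBarrier = fun ζ => (f ζ).re := by
    ext ξ
    have hre : ((ξ - (Real.pi / 2 : ℝ) * Complex.I) / 2).re = ξ.re / 2 := by simp
    have him : ((ξ - (Real.pi / 2 : ℝ) * Complex.I) / 2).im = (ξ.im - Real.pi / 2) / 2 := by
      simp
    simp only [f, stripBarrier, Complex.add_re, Complex.mul_re, Complex.exp_re, Complex.neg_re,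
      Complex.neg_im, Complex.re_ofNat, Complex.im_ofNat, hre, him, Real.cos_neg]
    ring
  rw [hf]
  exact (Differentiable.analyticAt (by fun_prop) ζ).harmonicAt_re

theorem continuous_stripBarrier : Continuous stripBarrier := by
  unfold stripBarrier
  fun_prop

theorem half_le_cos_sub_pi_div_two_div_two {θ : ℝ} (hθ : θ ∈ Icc 0 Real.pi) :
    1 / 2 ≤ Real.cos ((θ - Real.pi / 2) / 2) := by
  rw [← Real.cos_pi_div_three, ← Real.cos_abs ((θ - Real.pi / 2) / 2)]
  refine Real.cos_le_cos_of_nonneg_of_le_pi (abs_nonneg _) (by linarith [Real.pi_pos]) ?_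
  exact abs_le.2 ⟨by linarith [hθ.1, Real.pi_pos], by linarith [hθ.2, Real.pi_pos]⟩

theorem stripBarrier_nonneg {ζ : ℂ} (hζ : ζ.im ∈ Icc 0 Real.pi) : 0 ≤ stripBarrier ζ := by
  have hcos := half_le_cos_sub_pi_div_two_div_two hζ
  unfold stripBarrier
  positivity

theorem re_div_four_le_stripBarrier {ζ : ℂ} (hζ : ζ.im ∈ Icc 0 Real.pi) :
    ζ.re / 4 ≤ stripBarrier ζ := by
  have hexp : ζ.re / 2 ≤ Real.exp (ζ.re / 2) + 2 * Real.exp (-(ζ.re / 2)) := by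
    linarith [Real.add_one_le_exp (ζ.re / 2), Real.exp_pos (-(ζ.re / 2))]
  calc ζ.re / 4 = ζ.re / 2 * (1 / 2) := by ring
    _ ≤ (Real.exp (ζ.re / 2) + 2 * Real.exp (-(ζ.re / 2))) * (1 / 2) := by gcongr
    _ ≤ stripBarrier ζ :=
      mul_le_mul_of_nonneg_left (half_le_cos_sub_pi_div_two_div_two hζ) (by positivity)

theorem hasDerivAt_stripBarrier (θ : ℝ) :
    HasDerivAt (fun s : ℝ => stripBarrier (s + θ * Complex.I))
      (-(1 / 2) * Real.cos ((θ - Real.pi / 2) / 2)) 0 := by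
  have hre (s : ℝ) : ((s : ℂ) + θ * Complex.I).re = s := by simp
  have him (s : ℝ) : ((s : ℂ) + θ * Complex.I).im = θ := by simp
  simp only [stripBarrier, hre, him]
  refine HasDerivAt.mul_const ?_ _
  have hhalf : HasDerivAt (fun s : ℝ => s / 2) (1 / 2) 0 := (hasDerivAt_id 0).div_const 2
  refine (hhalf.exp.add (hhalf.neg.exp.const_mul 2)).congr_deriv ?_
  norm_num

theorem hasDerivWithinAt_nonpos_of_isMaxOn_Icc {f : ℝ → ℝ} {f' a b : ℝ} (hab : a < b)
    (hf : HasDerivWithinAt f f' (Icc a b) a) (hmax : IsMaxOn f (Icc a b) a) : f' ≤ 0 := by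
  have h := hmax.localize.hasFDerivWithinAt_nonpos hf.hasFDerivWithinAt (y := b - a)
    (sub_mem_posTangentConeAt_of_segment_subset (segment_eq_Icc hab.le).subset)
  have h' : (b - a) * f' ≤ 0 := by simpa using h
  exact nonpos_of_mul_nonpos_right h' (sub_pos.2 hab)

/-- At a maximum of `g - ε • stripBarrier` on the edge `s = 0` the derivative in `s` would be
positive, so the maximum is attained on one of the other three sides. -/
theorem le_add_mul_stripBarrier {g : ℂ → ℝ} {S a b m ε : ℝ} (hS : 0 < S) (ha : 0 ≤ a)
    (hb : b ≤ Real.pi) (hε : 0 < ε) (hc : ContinuousOn g (Icc 0 S ×ℂ Icc a b))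
    (hmean : MeanValueOn g (Ioo 0 S ×ℂ Ioo a b))
    (hN : ∀ θ ∈ Ioo a b, HasDerivWithinAt (fun s : ℝ => g (s + θ * Complex.I)) 0 (Ici 0) 0)
    (hside : ∀ ζ ∈ Icc 0 S ×ℂ Icc a b, ζ.im = a ∨ ζ.im = b → g ζ ≤ m)
    (hend : ∀ ζ ∈ Icc 0 S ×ℂ Icc a b, ζ.re = S → g ζ ≤ m + ε * (S / 4)) {ζ : ℂ}
    (hζ : ζ ∈ Icc 0 S ×ℂ Icc a b) : g ζ ≤ m + ε * stripBarrier ζ := by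
  have hstrip : Icc a b ⊆ Icc 0 Real.pi := Icc_subset_Icc ha hb
  have hUK : Ioo 0 S ×ℂ Ioo a b ⊆ Icc 0 S ×ℂ Icc a b := fun ξ hξ =>
    ⟨Ioo_subset_Icc_self hξ.1, Ioo_subset_Icc_self hξ.2⟩
  have hbarrier : ContinuousOn (ε • stripBarrier) (Icc 0 S ×ℂ Icc a b) :=
    (continuous_stripBarrier.const_smul ε).continuousOn
  obtain ⟨ξ, ⟨hξ, hξU⟩, hmax⟩ :=
    (hmean.sub ((meanValueOn_of_harmonicOnNhd fun ξ _ => harmonicAt_stripBarrier ξ).const_smul ε)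
      (hc.mono hUK) (hbarrier.mono hUK)).exists_isMaxOn_mem_diff (isOpen_Ioo.reProdIm isOpen_Ioo)
      hUK (isCompact_Icc.reProdIm isCompact_Icc) ⟨ζ, hζ⟩ (hc.sub hbarrier)
  suffices hle : g ξ ≤ m + ε * stripBarrier ξ by
    have hζξ : g ζ - ε * stripBarrier ζ ≤ g ξ - ε * stripBarrier ξ := hmax hζ
    linarith
  obtain ⟨⟨hre0, hreS⟩, him⟩ := Complex.mem_reProdIm.1 hξ
  by_cases hξside : ξ.im = a ∨ ξ.im = b
  · linarith [hside ξ hξ hξside, mul_nonneg hε.le (stripBarrier_nonneg (hstrip him))]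
  rcases hreS.eq_or_lt with hreS | hreS
  · linarith [hend ξ hξ hreS,
      mul_le_mul_of_nonneg_left (hreS ▸ re_div_four_le_stripBarrier (hstrip him)) hε.le]
  rw [not_or] at hξside
  have him' : ξ.im ∈ Ioo a b := ⟨him.1.lt_of_ne' hξside.1, him.2.lt_of_ne hξside.2⟩
  have hre : ξ.re = 0 := by
    by_contra hne
    exact hξU ⟨⟨hre0.lt_of_ne' hne, hreS⟩, him'⟩
  have hξeq : ((0 : ℝ) : ℂ) + ξ.im * Complex.I = ξ := hre ▸ Complex.re_add_im ξ
  have hderiv := (hN ξ.im him').sub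
    ((hasDerivAt_stripBarrier ξ.im).hasDerivWithinAt.const_mul ε)
  have hnonpos := hasDerivWithinAt_nonpos_of_isMaxOn_Icc hS (hderiv.mono Icc_subset_Ici_self)
    fun s hs => by
      have hmem : (s : ℂ) + ξ.im * Complex.I ∈ Icc 0 S ×ℂ Icc a b := by
        simpa [Complex.mem_reProdIm] using ⟨hs, him⟩
      simpa only [mem_ofPred_eq, Pi.sub_apply, Pi.smul_apply, smul_eq_mul, hξeq] using hmax hmem
  linarith [mul_le_mul_of_nonneg_left (half_le_cos_sub_pi_div_two_div_two (hstrip him)) hε.le]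

theorem nonpos_of_forall_pos_le_mul {x c : ℝ} (h : ∀ ε > 0, x ≤ ε * c) : x ≤ 0 := by
  have hlim : Filter.Tendsto (fun ε => ε * c) (nhdsWithin 0 (Ioi 0)) (nhds 0) := by
    simpa using ((continuous_mul_const c).tendsto 0).mono_left nhdsWithin_le_nhds
  exact ge_of_tendsto hlim (eventually_mem_nhdsWithin.mono h)

theorem nonpos_of_neumann_halfStrip {F : ℂ → ℝ} {C : ℝ}
    (hF : ContinuousOn F (Ici 0 ×ℂ Icc 0 Real.pi)) (hC : ∀ ζ ∈ Ici 0 ×ℂ Icc 0 Real.pi, F ζ ≤ C)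
    (hmean : MeanValueOn F (Ioi 0 ×ℂ Ioo 0 Real.pi))
    (hN : ∀ θ ∈ Ioo 0 Real.pi,
      HasDerivWithinAt (fun s : ℝ => F (s + θ * Complex.I)) 0 (Ici 0) 0)
    (hside : ∀ ζ ∈ Ici 0 ×ℂ Icc 0 Real.pi, ζ.im = 0 ∨ ζ.im = Real.pi → F ζ ≤ 0) {ζ : ℂ}
    (hζ : ζ ∈ Ici 0 ×ℂ Icc 0 Real.pi) : F ζ ≤ 0 := by
  refine nonpos_of_forall_pos_le_mul (c := stripBarrier ζ) fun ε hε => ?_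
  set S : ℝ := max (ζ.re + 1) (4 * C / ε)
  have hζS : ζ.re < S := (lt_add_one _).trans_le (le_max_left _ _)
  have hCS : C ≤ ε * (S / 4) := by
    have h : 4 * C / ε ≤ S := le_max_right _ _
    rw [div_le_iff₀ hε] at h
    linarith
  have hsub : Icc 0 S ×ℂ Icc 0 Real.pi ⊆ Ici 0 ×ℂ Icc 0 Real.pi := fun ξ hξ => ⟨hξ.1.1, hξ.2⟩
  simpa using le_add_mul_stripBarrier (m := 0) ((mem_Ici.1 hζ.1).trans_lt hζS) le_rfl le_rfl hε
    (hF.mono hsub) (hmean.mono fun ξ hξ => ⟨hξ.1.1, hξ.2⟩) hN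
    (fun ξ hξ => hside ξ (hsub hξ)) (fun ξ hξ _ => by linarith [hC ξ (hsub hξ)])
    ⟨⟨hζ.1, hζS.le⟩, hζ.2⟩

/-! ### Averaging along the boundary edge -/

/-- The average of `F` over vertical translations, with the normalized bump function `φ` as
weight. -/
noncomputable def verticalMollify (φ : ContDiffBump (0 : ℝ)) (F : ℂ → ℝ) (ζ : ℂ) : ℝ :=
  ∫ τ, φ.normed volume τ * F (ζ - τ * Complex.I)

section Mollify

variable (φ : ContDiffBump (0 : ℝ)) {F : ℂ → ℝ}

theorem verticalMollify_eq_intervalIntegral (F : ℂ → ℝ) (ζ : ℂ) :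
    verticalMollify φ F ζ =
      ∫ τ in -φ.rOut..φ.rOut, φ.normed volume τ * F (ζ - τ * Complex.I) := by
  refine (intervalIntegral.integral_eq_integral_of_support_subset fun τ hτ => ?_).symm
  have hτ' : τ ∈ Metric.ball 0 φ.rOut := φ.support_normed_eq (μ := volume) ▸ left_ne_zero_of_mul hτ
  rw [Real.ball_eq_Ioo, zero_sub, zero_add] at hτ'
  exact Ioo_subset_Ioc_self hτ'

theorem continuous_verticalMollify (hF : Continuous F) : Continuous (verticalMollify φ F) := by
  have hφ : Continuous (φ.normed volume) := φ.continuous_normed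
  rw [funext (verticalMollify_eq_intervalIntegral φ F)]
  exact intervalIntegral.continuous_parametric_intervalIntegral_of_continuous' (by fun_prop) _ _

theorem exists_forall_dist_sub_ofReal_mul_I_le (hF : Continuous F) {K : Set ℂ} (hK : IsCompact K)
    {ε : ℝ} (hε : 0 < ε) :
    ∃ δ > 0, ∀ ζ ∈ K, ∀ τ : ℝ, |τ| < δ → dist (F (ζ - τ * Complex.I)) (F ζ) ≤ ε := by
  obtain ⟨δ, hδ, hunif⟩ := Metric.mem_uniformity_dist.1
    (hK.uniformContinuousAt_of_continuousAt F (fun ζ _ => hF.continuousAt)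
      (Metric.dist_mem_uniformity hε))
  refine ⟨δ, hδ, fun ζ hζ τ hτ => ?_⟩
  rw [dist_comm]
  exact (hunif (by simpa [dist_eq_norm] using hτ) hζ).le

theorem dist_verticalMollify_le (hF : Continuous F) {ζ : ℂ} {ε : ℝ}
    (hε : ∀ τ : ℝ, |τ| < φ.rOut → dist (F (ζ - τ * Complex.I)) (F ζ) ≤ ε) :
    dist (verticalMollify φ F ζ) (F ζ) ≤ ε := by
  have hshift (τ : ℝ) : (ζ.re : ℂ) + ((ζ.im - τ : ℝ) : ℂ) * Complex.I = ζ - τ * Complex.I := by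
    apply Complex.ext <;> simp
  have h := φ.dist_normed_convolution_le (μ := volume) (x₀ := ζ.im) (ε := ε)
    (g := fun t : ℝ => F (ζ.re + t * Complex.I))
    (Continuous.aestronglyMeasurable (by fun_prop)) fun t ht => by
      have := hε (ζ.im - t) (by rwa [← Real.dist_eq, dist_comm])
      rwa [← hshift, sub_sub_cancel, ← congrArg F (Complex.re_add_im ζ)] at this
  simpa only [MeasureTheory.convolution, ContinuousLinearMap.lsmul_apply, smul_eq_mul, hshift,
    Complex.re_add_im, verticalMollify] using h

theorem MeanValueOn.verticalMollify {U V : Set ℂ} (hmean : MeanValueOn F U) (hF : Continuous F)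
    (hVU : ∀ ζ ∈ V, ∀ τ ∈ Icc (-φ.rOut) φ.rOut, ζ - τ * Complex.I ∈ U) :
    MeanValueOn (verticalMollify φ F) V := by
  intro ζ R hR hball
  have hφ : Continuous (φ.normed volume) := φ.continuous_normed
  have hle : -φ.rOut ≤ φ.rOut := by linarith [φ.rOut_pos]
  have htranslate : ∀ τ ∈ Icc (-φ.rOut) φ.rOut,
      Real.circleAverage F (ζ - τ * Complex.I) R = F (ζ - τ * Complex.I) := fun τ hτ => by
    refine hmean _ R hR fun ξ hξ => ?_
    have hξ' : ξ + τ * Complex.I ∈ Metric.closedBall ζ R := by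
      rw [mem_closedBall_iff_norm] at hξ ⊢
      rwa [← sub_sub_eq_add_sub]
    simpa using hVU _ (hball hξ') τ hτ
  have hcont : Continuous fun p : ℝ × ℝ =>
      φ.normed volume p.2 * F (circleMap (ζ - p.2 * Complex.I) R p.1) := by
    unfold circleMap
    fun_prop
  have hmap (θ τ : ℝ) : circleMap ζ R θ - τ * Complex.I = circleMap (ζ - τ * Complex.I) R θ :=
    add_sub_right_comm _ _ _
  simp only [Real.circleAverage_def, verticalMollify_eq_intervalIntegral, hmap]
  rw [intervalIntegral_intervalIntegral_swap
    (F := fun θ (τ : ℝ) => φ.normed volume τ * F (circleMap (ζ - τ * Complex.I) R θ))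
    ((hcont.continuousOn.integrableOn_compact (isCompact_uIcc.prod isCompact_uIcc)).mono_set
      (prod_mono uIoc_subset_uIcc uIoc_subset_uIcc)),
    ← intervalIntegral.integral_smul]
  refine intervalIntegral.integral_congr fun τ hτ => ?_
  rw [uIcc_of_le hle] at hτ
  simp only [intervalIntegral.integral_const_mul]
  rw [← htranslate τ hτ, Real.circleAverage_def, mul_smul_comm]

theorem isTestFunction_normed_comp_sub {U : Set ℝ} {θ : ℝ}
    (hU : ∀ σ, |θ - σ| ≤ φ.rOut → σ ∈ U) :
    IsTestFunction U fun σ => φ.normed volume (θ - σ) := by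
  refine ⟨φ.contDiff_normed.comp (contDiff_const.sub contDiff_id),
    φ.hasCompactSupport_normed.comp_homeomorph (Homeomorph.subLeft θ), fun σ hσ => hU σ ?_⟩
  have hσ' : σ ∈ Homeomorph.subLeft θ ⁻¹' tsupport (φ.normed volume) :=
    tsupport_comp_eq_preimage (φ.normed volume) (Homeomorph.subLeft θ) ▸ hσ
  simpa [φ.tsupport_normed_eq] using hσ'

theorem verticalMollify_eq_integral_mul (F : ℂ → ℝ) (s θ : ℝ) :
    verticalMollify φ F (s + θ * Complex.I) =
      ∫ σ : ℝ, F (s + σ * Complex.I) * φ.normed volume (θ - σ) := by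
  rw [verticalMollify, ← integral_sub_left_eq_self _ volume θ]
  refine integral_congr_ae (.of_forall fun σ => ?_)
  simp only [Complex.ofReal_sub]
  rw [mul_comm]
  congr 2
  ring

theorem verticalMollify_le_add_mul_stripBarrier {S m ε : ℝ} (hS : 0 < S) (hε : 0 < ε)
    (hF : Continuous F) (hmean : MeanValueOn F (Ioi 0 ×ℂ Ioo 0 Real.pi))
    (hN : ∀ φ, IsTestFunction (Ioo 0 Real.pi) φ → HasDerivWithinAt
      (fun s : ℝ => ∫ θ in (0 : ℝ)..Real.pi, F (s + θ * Complex.I) * φ θ) 0 (Ici 0) 0)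
    (hside : ∀ ζ ∈ Icc 0 S ×ℂ Icc φ.rOut (Real.pi - φ.rOut),
      ζ.im = φ.rOut ∨ ζ.im = Real.pi - φ.rOut → verticalMollify φ F ζ ≤ m)
    (hend : ∀ ζ ∈ Icc 0 S ×ℂ Icc φ.rOut (Real.pi - φ.rOut),
      ζ.re = S → verticalMollify φ F ζ ≤ m + ε * (S / 4))
    {ζ : ℂ} (hζ : ζ ∈ Icc 0 S ×ℂ Icc φ.rOut (Real.pi - φ.rOut)) :
    verticalMollify φ F ζ ≤ m + ε * stripBarrier ζ := by
  have hr := φ.rOut_pos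
  refine le_add_mul_stripBarrier hS hr.le (by linarith) hε
    (continuous_verticalMollify φ hF).continuousOn (hmean.verticalMollify φ hF ?_) ?_ hside hend hζ
  · intro ξ hξ τ hτ
    simp only [Complex.mem_reProdIm, mem_Ioo, mem_Ioi, mem_Icc] at hξ hτ ⊢
    simp only [Complex.sub_re, Complex.mul_re, Complex.ofReal_re, Complex.I_re, Complex.ofReal_im,
      Complex.I_im, Complex.sub_im, Complex.mul_im]
    refine ⟨by linarith, by linarith, by linarith⟩
  · intro θ hθ
    have htest : IsTestFunction (Ioo 0 Real.pi) fun σ => φ.normed volume (θ - σ) :=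
      isTestFunction_normed_comp_sub φ fun σ hσ => by
        obtain ⟨h₁, h₂⟩ := abs_le.1 hσ
        exact ⟨by linarith [hθ.1], by linarith [hθ.2]⟩
    simpa only [verticalMollify_eq_integral_mul, intervalIntegral.integral_of_le Real.pi_pos.le,
      integral_Ioc_eq_integral_Ioo, htest.setIntegral_mul] using hN _ htest

end Mollify

theorem le_of_im_eq_or_of_forall_dist_le {F : ℂ → ℝ} {S r ε : ℝ} (hr : 0 ≤ r)
    (hclose : ∀ ζ ∈ Icc 0 S ×ℂ Icc 0 Real.pi, ∀ τ : ℝ, |τ| ≤ r →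
      dist (F (ζ - τ * Complex.I)) (F ζ) ≤ ε)
    (hside : ∀ ζ ∈ Ici 0 ×ℂ Icc 0 Real.pi, ζ.im = 0 ∨ ζ.im = Real.pi → F ζ ≤ 0) {ζ : ℂ}
    (hζ : ζ ∈ Icc 0 S ×ℂ Icc 0 Real.pi) (him : ζ.im = r ∨ ζ.im = Real.pi - r) : F ζ ≤ ε := by
  obtain ⟨τ, hτ, hτside⟩ : ∃ τ : ℝ, |τ| = r ∧ (ζ.im - τ = 0 ∨ ζ.im - τ = Real.pi) := by
    rcases him with h | h
    · exact ⟨r, abs_of_nonneg hr, .inl (by linarith)⟩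
    · exact ⟨-r, by rw [abs_neg, abs_of_nonneg hr], .inr (by linarith)⟩
  have hre : (ζ - τ * Complex.I).re = ζ.re := by simp
  have him' : (ζ - τ * Complex.I).im = ζ.im - τ := by simp
  have hle : F (ζ - τ * Complex.I) ≤ 0 := by
    refine hside _ ⟨?_, ?_⟩ (by rwa [him'])
    · rw [mem_preimage, hre]; exact hζ.1.1
    · rw [mem_preimage, him']
      rcases hτside with h | h <;> simp [h, Real.pi_pos.le]
  linarith [(abs_le.1 (hclose ζ hζ τ hτ.le)).1]

/-- The weak Neumann condition is the pointwise one for the averages of `F` along the edge, and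
these converge to `F` locally uniformly. -/
theorem nonpos_of_weakNeumann_halfStrip {F : ℂ → ℝ} {C : ℝ} (hF : Continuous F)
    (hC : ∀ ζ ∈ Ici 0 ×ℂ Icc 0 Real.pi, F ζ ≤ C)
    (hmean : MeanValueOn F (Ioi 0 ×ℂ Ioo 0 Real.pi))
    (hN : ∀ φ, IsTestFunction (Ioo 0 Real.pi) φ → HasDerivWithinAt
      (fun s : ℝ => ∫ θ in (0 : ℝ)..Real.pi, F (s + θ * Complex.I) * φ θ) 0 (Ici 0) 0)
    (hside : ∀ ζ ∈ Ici 0 ×ℂ Icc 0 Real.pi, ζ.im = 0 ∨ ζ.im = Real.pi → F ζ ≤ 0) {ζ : ℂ}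
    (hζ : ζ ∈ Ici 0 ×ℂ Icc 0 Real.pi) : F ζ ≤ 0 := by
  by_cases him : ζ.im = 0 ∨ ζ.im = Real.pi
  · exact hside ζ hζ him
  obtain ⟨hre, him₀, himπ⟩ : 0 ≤ ζ.re ∧ 0 < ζ.im ∧ ζ.im < Real.pi :=
    ⟨hζ.1, lt_of_le_of_ne hζ.2.1 fun h => him (.inl h.symm),
      lt_of_le_of_ne hζ.2.2 fun h => him (.inr h)⟩
  refine nonpos_of_forall_pos_le_mul (c := 3 + stripBarrier ζ) fun ε hε => ?_
  obtain ⟨S, hS, hCS⟩ : ∃ S, ζ.re < S ∧ C ≤ ε * (S / 4) := by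
    refine ⟨max (ζ.re + 1) (4 * C / ε), lt_max_of_lt_left (lt_add_one _), ?_⟩
    have h := (div_le_iff₀ hε).1 (le_max_right (ζ.re + 1) (4 * C / ε))
    linarith
  obtain ⟨δ, hδ, hclose⟩ := exists_forall_dist_sub_ofReal_mul_I_le hF
    (isCompact_Icc.reProdIm isCompact_Icc : IsCompact (Icc 0 S ×ℂ Icc 0 Real.pi)) hε
  obtain ⟨r, hr, hr'⟩ := exists_between (lt_min hδ (lt_min him₀ (sub_pos.2 himπ)))
  obtain ⟨hrδ, hrζ, hrπ⟩ : r < δ ∧ r < ζ.im ∧ r < Real.pi - ζ.im := by simpa using hr'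
  let φ : ContDiffBump (0 : ℝ) := ⟨r / 2, r, half_pos hr, half_lt_self hr⟩
  have hsub : Icc 0 S ×ℂ Icc r (Real.pi - r) ⊆ Icc 0 S ×ℂ Icc 0 Real.pi :=
    fun ξ hξ => ⟨hξ.1, hr.le.trans hξ.2.1, hξ.2.2.trans (sub_le_self _ hr.le)⟩
  have hdist : ∀ ξ ∈ Icc 0 S ×ℂ Icc r (Real.pi - r), |verticalMollify φ F ξ - F ξ| ≤ ε :=
    fun ξ hξ => dist_verticalMollify_le φ hF fun τ hτ => hclose ξ (hsub hξ) τ (hτ.trans hrδ)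
  have hζ' : ζ ∈ Icc 0 S ×ℂ Icc r (Real.pi - r) := ⟨⟨hre, hS.le⟩, hrζ.le, by linarith⟩
  have hmoll : verticalMollify φ F ζ ≤ 2 * ε + ε * stripBarrier ζ := by
    refine verticalMollify_le_add_mul_stripBarrier φ (hre.trans_lt hS) hε hF hmean hN ?_ ?_ hζ'
    · intro ξ hξ hξim
      have := le_of_im_eq_or_of_forall_dist_le hr.le
        (fun ζ hζ τ hτ => hclose ζ hζ τ (hτ.trans_lt hrδ)) hside (hsub hξ) hξim
      linarith [(abs_le.1 (hdist ξ hξ)).2]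
    · intro ξ hξ _
      linarith [(abs_le.1 (hdist ξ hξ)).2, hC ξ ⟨hξ.1.1, (hsub hξ).2⟩]
  linarith [(abs_le.1 (hdist ζ hζ')).1]

/-! ### Uniqueness -/

theorem harmonicAt_comp_analyticAt {f : ℂ → ℝ} {G : ℂ → ℂ} {z : ℂ} (hf : HarmonicAt f (G z))
    (hG : AnalyticAt ℂ G z) : HarmonicAt (fun ζ => f (G ζ)) z := by
  obtain ⟨R, hR, hball⟩ := Metric.isOpen_iff.1 (isOpen_setOfPred_harmonicAt f) (G z) hf
  obtain ⟨H, hH, hHf⟩ := HarmonicOnNhd.exists_analyticOnNhd_ball_re_eq (f := f) (z := G z) (R := R)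
    fun y hy => hball hy
  have hHG : AnalyticAt ℂ (fun ζ => H (G ζ)) z := (hH (G z) (Metric.mem_ball_self hR)).comp hG
  refine (harmonicAt_congr_nhds ?_).2 hHG.harmonicAt_re
  filter_upwards [hG.continuousAt (Metric.ball_mem_nhds _ hR)] with ζ hζ
  exact (hHf hζ).symm

section PullbackExp

variable {u : ℂ → ℝ}

theorem meanValueOn_comp_exp (hu : HarmonicOnNhd u fluidDomain) :
    MeanValueOn (fun ζ => u (Complex.exp ζ)) (Ioi 0 ×ℂ Ioo 0 Real.pi) :=
  meanValueOn_of_harmonicOnNhd fun _ hζ =>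
    harmonicAt_comp_analyticAt (hu _ (exp_mem_fluidDomain hζ)) analyticAt_cexp

theorem ofReal_add_ofReal_mul_I_mem_strip {s θ : ℝ} (hs : 0 ≤ s) (hθ : θ ∈ Icc 0 Real.pi) :
    (s + θ * Complex.I : ℂ) ∈ Ici 0 ×ℂ Icc 0 Real.pi := by
  simpa [Complex.mem_reProdIm] using And.intro hs hθ

theorem ClassicalNeumann.hasDerivWithinAt_comp_exp (hu : ClassicalNeumann u) {θ : ℝ}
    (hθ : θ ∈ Ioo 0 Real.pi) :
    HasDerivWithinAt (fun s : ℝ => u (Complex.exp (s + θ * Complex.I))) 0 (Ici 0) 0 := by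
  have hmem := exp_ofReal_mul_I_mem_halfCircle hθ
  obtain ⟨hdiff, hradial⟩ := hu _ hmem
  rw [radialDeriv_of_mem_halfCircle u hmem] at hradial
  have hγ : HasDerivAt (fun s : ℝ => Complex.exp (s + θ * Complex.I))
      (Complex.exp (θ * Complex.I)) 0 := by
    simpa using ((Complex.ofRealCLM.hasDerivAt (x := (0 : ℝ))).add_const (θ * Complex.I)).cexp
  have hmaps : MapsTo (fun s : ℝ => Complex.exp (s + θ * Complex.I)) (Ici 0)
      (closure fluidDomain) := fun s hs => exp_mem_closure_fluidDomain
    (ofReal_add_ofReal_mul_I_mem_strip hs (Ioo_subset_Icc_self hθ))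
  have h := hdiff.hasFDerivWithinAt.comp_hasDerivWithinAt_of_eq 0 hγ.hasDerivWithinAt hmaps
    (by simp)
  rwa [hradial] at h

theorem WeakNeumann.hasDerivWithinAt_integral_comp_exp (hu : WeakNeumann u) {φ : ℝ → ℝ}
    (hφ : IsTestFunction (Ioo 0 Real.pi) φ) :
    HasDerivWithinAt
      (fun s : ℝ => ∫ θ in (0 : ℝ)..Real.pi, u (Complex.exp (s + θ * Complex.I)) * φ θ)
      0 (Ici 0) 0 := by
  have h := HasDerivWithinAt.comp_of_eq (0 : ℝ) (h := Real.exp)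
    (hu φ hφ.contDiff hφ.hasCompactSupport hφ.tsupport_subset)
    ((Real.hasDerivAt_exp 0).hasDerivWithinAt (s := Ici 0))
    (fun s hs => Real.one_le_exp hs) Real.exp_zero.symm
  simpa only [zero_mul, Function.comp_def, polar_eq_ofReal_mul_exp, Complex.ofReal_exp,
    ← Complex.exp_add] using h

theorem ofReal_mem_closure_fluidDomain {x : ℝ} (hx : 1 ≤ |x|) :
    (x : ℂ) ∈ closure fluidDomain :=
  mem_closure_fluidDomain.2 (by simpa using hx)

theorem ofReal_nonpos_of_forall_freeSurface (hu : ContinuousOn u (closure fluidDomain))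
    (htr : ∀ x ∈ freeSurface, u (x : ℂ) ≤ 0) {x : ℝ} (hx : 1 ≤ |x|) : u (x : ℂ) ≤ 0 := by
  refine le_on_closure htr (hu.comp Complex.continuous_ofReal.continuousOn fun y hy => ?_)
    continuousOn_const (closure_freeSurface ▸ hx : x ∈ closure freeSurface)
  exact ofReal_mem_closure_fluidDomain (closure_freeSurface ▸ hy :)

theorem comp_exp_nonpos_of_im_eq_zero_or_pi (hu : ContinuousOn u (closure fluidDomain))
    (htr : ∀ x ∈ freeSurface, u (x : ℂ) ≤ 0) {ζ : ℂ} (hζ : ζ ∈ Ici 0 ×ℂ Icc 0 Real.pi)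
    (him : ζ.im = 0 ∨ ζ.im = Real.pi) : u (Complex.exp ζ) ≤ 0 := by
  have hreal : (Complex.exp ζ).im = 0 := by
    rcases him with h | h <;> simp [Complex.exp_im, h]
  rw [← Complex.re_add_im (Complex.exp ζ), hreal, Complex.ofReal_zero, zero_mul, add_zero]
  refine ofReal_nonpos_of_forall_freeSurface hu htr ?_
  rw [Complex.abs_re_eq_norm.2 hreal]
  exact (mem_closure_fluidDomain.1 (exp_mem_closure_fluidDomain hζ)).1

theorem continuousOn_comp_exp (hu : ContinuousOn u (closure fluidDomain)) :
    ContinuousOn (fun ζ => u (Complex.exp ζ)) (Ici 0 ×ℂ Icc 0 Real.pi) :=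
  hu.comp Complex.continuous_exp.continuousOn fun _ => exp_mem_closure_fluidDomain

end PullbackExp

section Comparison

variable {v v₁ v₂ : ℝ → ℝ} {ψ ψ₁ ψ₂ : ℂ → ℝ}

theorem ContinuousBounded.sub (h₁ : ContinuousBounded ψ₁) (h₂ : ContinuousBounded ψ₂) :
    ContinuousBounded (ψ₁ - ψ₂) := by
  obtain ⟨hc₁, C₁, hC₁⟩ := h₁
  obtain ⟨hc₂, C₂, hC₂⟩ := h₂
  exact ⟨hc₁.sub hc₂, C₁ + C₂,
    fun z hz => (abs_sub _ _).trans (add_le_add (hC₁ z hz) (hC₂ z hz))⟩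

theorem ClassicalNeumann.sub (h₁ : ClassicalNeumann ψ₁) (h₂ : ClassicalNeumann ψ₂) :
    ClassicalNeumann (ψ₁ - ψ₂) := by
  intro z hz
  obtain ⟨hd₁, hr₁⟩ := h₁ z hz
  obtain ⟨hd₂, hr₂⟩ := h₂ z hz
  have hz' : z ∈ closure fluidDomain :=
    mem_closure_fluidDomain.2 ⟨(mem_halfCircle.1 hz).1.ge, hz.2.le⟩
  refine ⟨hd₁.sub hd₂, ?_⟩
  rw [radialDeriv_of_mem_halfCircle _ hz] at hr₁ hr₂ ⊢
  rw [fderivWithin_sub (uniqueDiffOn_closure_fluidDomain z hz') hd₁ hd₂, sub_apply, hr₁, hr₂,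
    sub_zero]

theorem intervalIntegrable_polar_mul (hψ : ContinuousOn ψ (closure fluidDomain)) {φ : ℝ → ℝ}
    (hφ : Continuous φ) {r : ℝ} (hr : 1 ≤ r) :
    IntervalIntegrable (fun θ => ψ ⟨r * Real.cos θ, r * Real.sin θ⟩ * φ θ) volume 0 Real.pi := by
  simp only [polar_eq_ofReal_mul_exp]
  refine ((hψ.comp (by fun_prop) fun θ hθ => ?_).mul hφ.continuousOn).intervalIntegrable
  rw [uIcc_of_le Real.pi_pos.le] at hθ
  have h := exp_mem_closure_fluidDomain
    (ofReal_add_ofReal_mul_I_mem_strip (Real.log_nonneg hr) hθ)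
  rwa [Complex.exp_add, ← Complex.ofReal_exp, Real.exp_log (zero_lt_one.trans_le hr)] at h

theorem WeakNeumann.sub (hc₁ : ContinuousOn ψ₁ (closure fluidDomain))
    (hc₂ : ContinuousOn ψ₂ (closure fluidDomain)) (h₁ : WeakNeumann ψ₁) (h₂ : WeakNeumann ψ₂) :
    WeakNeumann (ψ₁ - ψ₂) := by
  intro φ hφ hφc hφt
  have hsub (r : ℝ) (hr : 1 ≤ r) :
      ∫ θ in (0 : ℝ)..Real.pi, (ψ₁ - ψ₂) ⟨r * Real.cos θ, r * Real.sin θ⟩ * φ θ =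
        (∫ θ in (0 : ℝ)..Real.pi, ψ₁ ⟨r * Real.cos θ, r * Real.sin θ⟩ * φ θ) -
          ∫ θ in (0 : ℝ)..Real.pi, ψ₂ ⟨r * Real.cos θ, r * Real.sin θ⟩ * φ θ := by
    rw [← intervalIntegral.integral_sub (intervalIntegrable_polar_mul hc₁ hφ.continuous hr)
      (intervalIntegrable_polar_mul hc₂ hφ.continuous hr)]
    simp only [Pi.sub_apply, sub_mul]
  have h := ((h₁ φ hφ hφc hφt).sub (h₂ φ hφ hφc hφt)).congr hsub (hsub 1 le_rfl)
  rwa [sub_zero] at h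

theorem IsClassicalSolution.sub (h₁ : IsClassicalSolution v₁ ψ₁) (h₂ : IsClassicalSolution v₂ ψ₂) :
    IsClassicalSolution (v₁ - v₂) (ψ₁ - ψ₂) where
  continuousBounded := h₁.continuousBounded.sub h₂.continuousBounded
  harmonic := h₁.harmonic.sub h₂.harmonic
  neumann := h₁.neumann.sub h₂.neumann
  trace x hx := congrArg₂ (· - ·) (h₁.trace x hx) (h₂.trace x hx)

theorem IsWeakSolution.sub (h₁ : IsWeakSolution v₁ ψ₁) (h₂ : IsWeakSolution v₂ ψ₂) :
    IsWeakSolution (v₁ - v₂) (ψ₁ - ψ₂) where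
  continuousBounded := h₁.continuousBounded.sub h₂.continuousBounded
  harmonic := h₁.harmonic.sub h₂.harmonic
  neumann := h₁.neumann.sub h₁.continuousBounded.1 h₂.continuousBounded.1 h₂.neumann
  trace x hx := congrArg₂ (· - ·) (h₁.trace x hx) (h₂.trace x hx)

theorem IsClassicalSolution.nonpos (hψ : IsClassicalSolution v ψ)
    (hv : ∀ x ∈ freeSurface, v x ≤ 0) {z : ℂ} (hz : z ∈ closure fluidDomain) : ψ z ≤ 0 := by
  obtain ⟨hcont, C, hC⟩ := hψ.continuousBounded
  obtain ⟨ζ, hζ, rfl⟩ := image_exp_strip ▸ hz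
  exact nonpos_of_neumann_halfStrip (F := fun ζ => ψ (Complex.exp ζ))
    (continuousOn_comp_exp hcont)
    (fun ξ hξ => (abs_le.1 (hC _ (exp_mem_closure_fluidDomain hξ))).2)
    (meanValueOn_comp_exp hψ.harmonic) (fun θ => hψ.neumann.hasDerivWithinAt_comp_exp)
    (fun ξ => comp_exp_nonpos_of_im_eq_zero_or_pi hcont
      fun x hx => (hψ.trace x hx).trans_le (hv x hx)) hζ

theorem IsWeakSolution.nonpos (hψ : IsWeakSolution v ψ) (hv : ∀ x ∈ freeSurface, v x ≤ 0) {z : ℂ}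
    (hz : z ∈ closure fluidDomain) : ψ z ≤ 0 := by
  obtain ⟨hcont, C, hC⟩ := hψ.continuousBounded
  obtain ⟨F, hF⟩ := ContinuousMap.exists_restrict_eq (isClosed_Ici.reProdIm isClosed_Icc)
    ⟨_, (continuousOn_comp_exp hcont).domRestrict⟩
  have hFψ : EqOn F (fun ζ => ψ (Complex.exp ζ)) (Ici 0 ×ℂ Icc 0 Real.pi) :=
    fun ξ hξ => DFunLike.congr_fun hF ⟨ξ, hξ⟩
  obtain ⟨ζ, hζ, rfl⟩ := image_exp_strip ▸ hz
  refine (hFψ hζ).symm.trans_le (nonpos_of_weakNeumann_halfStrip (C := C) F.continuous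
    (fun ξ hξ => ?_) ?_ (fun φ hφ => ?_) (fun ξ hξ him => ?_) hζ)
  · exact (hFψ hξ).trans_le (abs_le.1 (hC _ (exp_mem_closure_fluidDomain hξ))).2
  · exact (meanValueOn_comp_exp hψ.harmonic).congr
      (hFψ.mono (Complex.reProdIm_subset_iff'.2
        (.inl ⟨Ioi_subset_Ici_self, Ioo_subset_Icc_self⟩)))
  · have hint (s : ℝ) (hs : 0 ≤ s) : ∫ θ in (0 : ℝ)..Real.pi, F (s + θ * Complex.I) * φ θ =
        ∫ θ in (0 : ℝ)..Real.pi, ψ (Complex.exp (s + θ * Complex.I)) * φ θ := by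
      refine intervalIntegral.integral_congr fun θ hθ => ?_
      rw [uIcc_of_le Real.pi_pos.le] at hθ
      exact congrArg (· * φ θ) (hFψ (ofReal_add_ofReal_mul_I_mem_strip hs hθ))
    exact (hψ.neumann.hasDerivWithinAt_integral_comp_exp hφ).congr hint (hint 0 le_rfl)
  · exact (hFψ hξ).trans_le (comp_exp_nonpos_of_im_eq_zero_or_pi hcont
      (fun x hx => (hψ.trace x hx).trans_le (hv x hx)) hξ him)

theorem IsClassicalSolution.eqOn (h₁ : IsClassicalSolution v ψ₁) (h₂ : IsClassicalSolution v ψ₂) :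
    EqOn ψ₁ ψ₂ (closure fluidDomain) := fun _ hz =>
  le_antisymm (sub_nonpos.1 ((h₁.sub h₂).nonpos (fun x _ => (sub_self (v x)).le) hz))
    (sub_nonpos.1 ((h₂.sub h₁).nonpos (fun x _ => (sub_self (v x)).le) hz))

theorem IsWeakSolution.eqOn (h₁ : IsWeakSolution v ψ₁) (h₂ : IsWeakSolution v ψ₂) :
    EqOn ψ₁ ψ₂ (closure fluidDomain) := fun _ hz =>
  le_antisymm (sub_nonpos.1 ((h₁.sub h₂).nonpos (fun x _ => (sub_self (v x)).le) hz))
    (sub_nonpos.1 ((h₂.sub h₁).nonpos (fun x _ => (sub_self (v x)).le) hz))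

end Comparison

end FloatingBody

theorem mainTheorem3_general {w : ℝ → ℝ} {C : ℝ}
    (hw : ContinuousOn w (closure FloatingBody.freeSurface)) (hC : ∀ x, 1 ≤ |x| → |w x| ≤ C) :
    FloatingBody.IsClassicalSolution w (FloatingBody.dirichletOmega w) ∧
    FloatingBody.IsWeakSolution w (FloatingBody.dirichletOmega w) ∧
    (∀ Φ : ℂ → ℝ, FloatingBody.IsClassicalSolution w Φ ∨ FloatingBody.IsWeakSolution w Φ →
      EqOn Φ (FloatingBody.dirichletOmega w) (closure FloatingBody.fluidDomain)) ∧
    EqOn (FloatingBody.dirichletOmega w)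
      (FloatingBody.dirichletHalfPlane (FloatingBody.symmExtension w))
      (closure FloatingBody.fluidDomain) ∧
    (∀ x y : ℝ, 0 ≤ y → 0 < x ^ 2 + y ^ 2 → x ^ 2 + y ^ 2 < 1 →
      FloatingBody.dirichletHalfPlane (FloatingBody.symmExtension w) ⟨x, y⟩ =
        FloatingBody.dirichletOmega w ⟨x / (x ^ 2 + y ^ 2), y / (x ^ 2 + y ^ 2)⟩) := by
  have hclassical := FloatingBody.isClassicalSolution_dirichletOmega hw hC
  have hweak := FloatingBody.isWeakSolution_dirichletOmega hw hC
  exact ⟨hclassical, hweak, fun Φ hΦ => hΦ.elim (·.eqOn hclassical) (·.eqOn hweak),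
    FloatingBody.eqOn_dirichletOmega_dirichletHalfPlane hw hC, fun _ _ =>
      FloatingBody.dirichletHalfPlane_symmExtension_eq_dirichletOmega_inversion hw hC⟩

theorem mainTheorem3 (v : ℝ → ℝ) (hv : FloatingBody.MemW12 FloatingBody.freeSurface v) :
    -- `w` is the continuous representative of `v` on the closure of the free surface
    ∃ w : ℝ → ℝ, ContinuousOn w (closure FloatingBody.freeSurface) ∧
      v =ᵐ[volume.restrict FloatingBody.freeSurface] w ∧
      -- existence
      FloatingBody.IsClassicalSolution w (FloatingBody.dirichletOmega w) ∧
      FloatingBody.IsWeakSolution w (FloatingBody.dirichletOmega w) ∧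
      -- uniqueness
      (∀ Φ : ℂ → ℝ, FloatingBody.IsClassicalSolution w Φ ∨ FloatingBody.IsWeakSolution w Φ →
        EqOn Φ (FloatingBody.dirichletOmega w) (closure FloatingBody.fluidDomain)) ∧
      -- the solution is the restriction of the half-plane Poisson extension of the symmetric
      -- extension of `w`, which inside the unit disc is its reflection in the circle
      EqOn (FloatingBody.dirichletOmega w)
        (FloatingBody.dirichletHalfPlane (FloatingBody.symmExtension w))
        (closure FloatingBody.fluidDomain) ∧
      (∀ x y : ℝ, 0 ≤ y → 0 < x ^ 2 + y ^ 2 → x ^ 2 + y ^ 2 < 1 →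
        FloatingBody.dirichletHalfPlane (FloatingBody.symmExtension w) ⟨x, y⟩ =
          FloatingBody.dirichletOmega w
            ⟨x / (x ^ 2 + y ^ 2), y / (x ^ 2 + y ^ 2)⟩) := by
  obtain ⟨w, hw, hvw, C, hC⟩ := hv.exists_bounded_continuousOn_ae_eq
  exact ⟨w, hw, hvw, mainTheorem3_general hw hC⟩
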